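/- Let $q\ge 1$ and $t>0$. Let $\mathcal H$ be the Hilbert space of (complex-valued) square integrable differential forms of all degrees on $\mathbb R^q$, let $d$ be the exterior derivative, $d^*$ its adjoint, and $D=d+d^*$ the self-adjoint Dirac operator. Let $\phi_{n}$ denote the unique solution of $\phi''(r)+(n-1)\phi'(r)/r+\phi(r)=0$, $\phi(0)=1$, $\phi'(0)=0$. Then $t\,\phi_{q+2}(tD)\,d$, where $\phi_{q+2}(tD)$ is given by the functional calculus of $D$ and where the operator is first defined on rapidly decreasing smooth forms, extends uniquely to a bounded operator $d_t$ on $\mathcal H$. Let $f$ be a continuous $(q-1)$-form on $\mathbb R^q$. For $p\in\mathbb R^q$ let $W_t(p)$ be the sphere of radius $t$ centered at $p$, oriented by the outward normal, with surface area $|W_t(p)|$ (for $q=1$: the two points $p\pm t$ with counting measure), and define the $q$-form $$u(p)=q\cdot\Big(\frac{1}{|W_t(p)|}\int_{W_t(p)} f\Big)\,dx_1\wedge\dots\wedge dx_q ,$$ that is, $q$ times the average flux of $f$ through $W_t(p)$. Then $u$ is continuous and $d_tf=u$, in the following sense: if $f$ is square integrable, then $u$ is the continuous representative of $d_tf\in\mathcal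 H$; and for an arbitrary continuous $f$, $d_tf=u$ in the sense of distributions, i.e. for every smooth compactly supported form $\psi$ the integral $\int_{\mathbb R^q}\langle d_t^*\psi,f\rangle\,dx$ (with $d_t^*$ the adjoint of the bounded operator $d_t$) converges absolutely and equals $\int_{\mathbb R^q}\langle\psi,u\rangle\,dx$. -/

import Mathlib

open MeasureTheory SchwartzMap
open scoped FourierTransform LineDeriv Real

/-! ### Differential forms on `ℝ^q` and the Dirac operator -/

/-- Euclidean space `ℝ^q`. -/
abbrev Space (q : ℕ) := EuclideanSpace ℝ (Fin q)

/-- The exterior algebra `⨁ₖ Λᵏ(ℝ^q)* ⊗ ℂ` with its Hermitian inner product, written in the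
orthonormal basis `dx_I = dx_{i₁} ∧ … ∧ dx_{iₖ}`, where `I = {i₁ < … < iₖ}` runs over the subsets
of the index set.  The degree of `dx_I` is the number of elements of `I`. -/
abbrev FormFiber (q : ℕ) := EuclideanSpace ℂ (Finset (Fin q))

/-- The Hilbert space of square integrable differential forms (of all degrees) on `ℝ^q`. -/
noncomputable abbrev FormL2 (q : ℕ) := Lp (FormFiber q) 2 (volume : Measure (Space q))

/-- The `i`-th standard basis vector of `ℝ^q`. -/
noncomputable abbrev stdVec {q : ℕ} (i : Fin q) : Space q := EuclideanSpace.single i (1 : ℝ)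

/-- Exterior multiplication `ω ↦ dx_i ∧ ω`: it sends `dx_J` with `i ∉ J` to
`(-1)^{#{j ∈ J : j < i}} dx_{J ∪ {i}}`, and `dx_J` with `i ∈ J` to `0`. -/
noncomputable def wedge {q : ℕ} (i : Fin q) : FormFiber q →L[ℂ] FormFiber q :=
  LinearMap.toContinuousLinearMap
    { toFun := fun ω => WithLp.toLp 2 fun I =>
        if i ∈ I then (-1 : ℂ) ^ (I.filter (· < i)).card * ω (I.erase i) else 0
      map_add' := by
        intro x y
        ext I
        by_cases h : i ∈ I <;> simp [h, mul_add]
      map_smul' := by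
        intro c x
        ext I
        by_cases h : i ∈ I <;> simp [h, mul_left_comm] }

/-- Interior multiplication `ω ↦ ι_{e_i} ω`, the adjoint of `ω ↦ dx_i ∧ ω`. -/
noncomputable def contract {q : ℕ} (i : Fin q) : FormFiber q →L[ℂ] FormFiber q :=
  ContinuousLinearMap.adjoint (wedge i)

/-- The exterior derivative `d ω = ∑ᵢ dx_i ∧ ∂ᵢ ω` on rapidly decreasing smooth forms. -/
noncomputable def extD {q : ℕ} (ω : 𝓢(Space q, FormFiber q)) : 𝓢(Space q, FormFiber q) :=
  ∑ i, postcompCLM (wedge i) (∂_{stdVec i} ω)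

/-- The codifferential `d* ω = -∑ᵢ ι_{e_i} ∂ᵢ ω`, the formal adjoint of `d`. -/
noncomputable def codiff {q : ℕ} (ω : 𝓢(Space q, FormFiber q)) : 𝓢(Space q, FormFiber q) :=
  -∑ i, postcompCLM (contract i) (∂_{stdVec i} ω)

/-- The Dirac operator `D = d + d*`. -/
noncomputable def dirac {q : ℕ} (ω : 𝓢(Space q, FormFiber q)) : 𝓢(Space q, FormFiber q) :=
  extD ω + codiff ω

/-- The symbol `σ(ξ) = ∑ᵢ 2πi ξ_i (dx_i ∧ · - ι_{e_i})` of the Dirac operator, a self-adjoint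
endomorphism of the fiber. -/
noncomputable def diracSymbol {q : ℕ} (ξ : Space q) : FormFiber q →L[ℂ] FormFiber q :=
  ∑ i, (2 * π * Complex.I * (ξ i : ℂ)) • (wedge i - contract i)

theorem isSelfAdjoint_diracSymbol {q : ℕ} (ξ : Space q) : IsSelfAdjoint (diracSymbol ξ) := by
  rw [isSelfAdjoint_iff, ContinuousLinearMap.star_eq_adjoint, diracSymbol, map_sum]
  refine Finset.sum_congr rfl fun i _ => ?_
  rw [map_smulₛₗ, map_sub, contract, ContinuousLinearMap.adjoint_adjoint,
    ← neg_sub (wedge i), smul_neg, ← neg_smul]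
  congr 1
  simp only [map_mul, Complex.conj_ofReal, Complex.conj_I, Complex.conj_ofNat]
  ring

/-- The Fourier transform diagonalizes `D`: it turns `D` into multiplication by the symbol. -/
theorem fourier_dirac {q : ℕ} (ω : 𝓢(Space q, FormFiber q)) (ξ : Space q) :
    𝓕 (dirac ω) ξ = diracSymbol ξ (𝓕 ω ξ) := by
  have hp : ∀ (L : FormFiber q →L[ℂ] FormFiber q) (η : 𝓢(Space q, FormFiber q)),
      𝓕 (postcompCLM L η) = postcompCLM L (𝓕 η) := by
    intro L η
    ext1 ξ
    rw [postcompCLM_apply, SchwartzMap.fourier_coe, SchwartzMap.fourier_coe, Real.fourier_eq,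
      Real.fourier_eq, ← L.integral_comp_comm]
    · congr 1
      ext1 v
      rw [postcompCLM_apply, Circle.smul_def, Circle.smul_def, map_smul]
    · rw [Real.fourierIntegral_convergent_iff]
      exact η.integrable
  have hd : ∀ i : Fin q, 𝓕 (∂_{stdVec i} ω) ξ = (2 * π * Complex.I * (ξ i : ℂ)) • 𝓕 ω ξ := by
    intro i
    have ht : (inner ℝ · (stdVec i) : Space q → ℝ).HasTemperateGrowth :=
      ((innerSL ℝ).flip (stdVec i)).hasTemperateGrowth
    rw [fourier_lineDerivOp_eq, _root_.smul_apply, smulLeftCLM_apply_apply ht]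
    have hi : inner ℝ ξ (stdVec i) = ξ i := by simp [EuclideanSpace.inner_single_right]
    rw [hi, mul_smul (2 * π * Complex.I : ℂ), Complex.coe_smul]
  have hneg : ∀ η : 𝓢(Space q, FormFiber q), 𝓕 (-η) = -𝓕 η := fun η =>
    (FourierTransform.fourierCLM ℂ 𝓢(Space q, FormFiber q)).map_neg η
  simp only [dirac, extD, codiff, FourierTransform.fourier_add, hneg,
    FourierTransform.fourier_sum, hp, _root_.add_apply, _root_.neg_apply,
    _root_.sum_apply, postcompCLM_apply, hd, diracSymbol, _root_.sum_apply,
    _root_.smul_apply, _root_.sub_apply, map_smul, smul_sub,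
    Finset.sum_sub_distrib]
  rw [sub_eq_add_neg]

/-- `d*` is the formal adjoint of `d`. -/
theorem integral_inner_extD {q : ℕ} (ω η : 𝓢(Space q, FormFiber q)) :
    ∫ x, inner ℂ (extD ω x) (η x) = ∫ x, inner ℂ (ω x) (codiff η x) := by
  let B : FormFiber q →L[ℝ] FormFiber q →L[ℝ] ℂ :=
    (isBoundedBilinearMap_inner (𝕜 := ℂ) (E := FormFiber q)).toContinuousLinearMap
  let L : Fin q → FormFiber q →L[ℝ] FormFiber q →L[ℝ] ℂ := fun i =>
    B.comp ((wedge i).restrictScalars ℝ)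
  have hL : ∀ i x y, L i x y = inner ℂ (wedge i x) y := fun _ _ _ => rfl
  have hL' : ∀ i x y, L i x y = inner ℂ x (contract i y) := fun i x y =>
    (ContinuousLinearMap.adjoint_inner_right (wedge i) x y).symm
  have hint : ∀ i (a b : 𝓢(Space q, FormFiber q)), Integrable fun x => L i (a x) (b x) :=
    fun i a b => (bilinLeftCLM (L i) b.hasTemperateGrowth a).integrable
  have h1 : ∀ x, inner ℂ (extD ω x) (η x) = ∑ i, L i (∂_{stdVec i} ω x) (η x) := by
    intro x
    simp only [extD, _root_.sum_apply, postcompCLM_apply, sum_inner, hL]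
  have h2 : ∀ x, inner ℂ (ω x) (codiff η x) = ∑ i, -L i (ω x) (∂_{stdVec i} η x) := by
    intro x
    simp only [codiff, _root_.neg_apply, _root_.sum_apply, postcompCLM_apply,
      inner_neg_right, inner_sum, hL', Finset.sum_neg_distrib]
  simp only [h1, h2]
  rw [integral_finsetSum _ fun i _ => hint i _ _,
    integral_finsetSum _ fun i _ => (hint i ω (∂_{stdVec i} η)).fun_neg]
  refine Finset.sum_congr rfl fun i _ => ?_
  rw [integral_neg, integral_bilinear_lineDerivOp_right_eq_neg_left, neg_neg]

/-- The functional calculus of the self-adjoint operator `D` on `L²` forms: the bounded operator `B`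
is `g(D)`.  The Fourier transform is a unitary equivalence between `D` and multiplication by the
self-adjoint matrix `σ(ξ)`, so `g(D)` corresponds to multiplication by the matrix `g(σ(ξ))`. -/
def IsFunctionOfDirac {q : ℕ} (g : ℝ → ℝ) (B : FormL2 q →L[ℂ] FormL2 q) : Prop :=
  ∀ f : FormL2 q, ∀ᵐ ξ, (𝓕 (B f) : FormL2 q) ξ = cfc g (diracSymbol ξ) ((𝓕 f : FormL2 q) ξ)

/-! ### The Bessel functions and the deformed exterior derivative -/

/-- `φ` is a solution of the Bessel type equation `φ'' + (n - 1) φ' / r + φ = 0` with `φ(0) = 1` and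
`φ'(0) = 0`. -/
structure IsBesselSolution (n : ℕ) (φ : ℝ → ℝ) : Prop where
  contDiff : ContDiff ℝ 2 φ
  map_zero : φ 0 = 1
  deriv_zero : deriv φ 0 = 0
  ode : ∀ r, r ≠ 0 → deriv (deriv φ) r + (n - 1) * (deriv φ r / r) + φ r = 0

/-- The Bessel function `φ_n(r) = ∑ₖ r^{2k} / ∏_{j=1}^{k} (-2j)(n - 2 + 2j)`. -/
noncomputable def besselPhi (n : ℕ) (r : ℝ) : ℝ :=
  ∑' k : ℕ, r ^ (2 * k) / ∏ j ∈ Finset.Icc 1 k, (-2 * (j : ℝ)) * ((n : ℝ) - 2 + 2 * j)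

theorem summable_powerSeries {c : ℕ → ℝ} (hc : ∀ k, |c k| ≤ 1 / k.factorial) (x : ℝ) :
    Summable fun k => c k * x ^ k := by
  refine Summable.of_norm_bounded (Real.summable_pow_div_factorial |x|) fun k => ?_
  rw [Real.norm_eq_abs, abs_mul, abs_pow, div_eq_inv_mul, ← one_div]
  exact mul_le_mul_of_nonneg_right (hc k) (by positivity)

theorem coeff_deriv_le {c : ℕ → ℝ} (hc : ∀ k, |c k| ≤ 1 / k.factorial) (k : ℕ) :
    |((k : ℝ) + 1) * c (k + 1)| ≤ 1 / k.factorial := by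
  have h := hc (k + 1)
  rw [Nat.factorial_succ] at h
  push_cast at h
  rw [abs_mul, abs_of_pos (by positivity : (0 : ℝ) < k + 1)]
  calc ((k : ℝ) + 1) * |c (k + 1)| ≤ (k + 1) * (1 / ((k + 1) * k.factorial)) := by gcongr
    _ = 1 / k.factorial := by field_simp

theorem hasDerivAt_powerSeries {c : ℕ → ℝ} (hc : ∀ k, |c k| ≤ 1 / k.factorial) (x : ℝ) :
    HasDerivAt (fun y => ∑' k, c k * y ^ k) (∑' k : ℕ, (((k : ℝ) + 1) * c (k + 1)) * x ^ k) x := by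
  have hs : Summable fun k : ℕ => c k * (k * x ^ (k - 1)) := by
    rw [← summable_nat_add_iff 1]
    refine (summable_powerSeries (coeff_deriv_le hc) x).congr fun k => ?_
    simp
    ring
  have key := hasDerivAt_tsum_of_isPreconnected (𝕜 := ℝ) (F := ℝ)
    (u := fun k : ℕ => (1 / k.factorial : ℝ) * (k * (|x| + 1) ^ (k - 1)))
    (t := Metric.ball 0 (|x| + 1)) (g := fun k y => c k * y ^ k)
    (g' := fun k y => c k * (k * y ^ (k - 1))) (y₀ := 0) (y := x)
    ?_ Metric.isOpen_ball (convex_ball _ _).isPreconnected ?_ ?_ ?_ ?_ ?_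
  · have e : ∑' k : ℕ, (((k : ℝ) + 1) * c (k + 1)) * x ^ k =
        ∑' k : ℕ, c k * (k * x ^ (k - 1)) := by
      rw [hs.tsum_eq_zero_add]
      simp only [CharP.cast_eq_zero, zero_mul, mul_zero, zero_add, Nat.add_sub_cancel]
      refine tsum_congr fun k => ?_
      push_cast
      ring
    rw [e]
    exact key
  · rw [← summable_nat_add_iff 1]
    refine (Real.summable_pow_div_factorial (|x| + 1)).congr fun k => ?_
    rw [Nat.factorial_succ, Nat.add_sub_cancel]
    push_cast
    field_simp
  · intro k y _
    exact (hasDerivAt_pow k y).const_mul (c k)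
  · intro k y hy
    have hy' : |y| ≤ |x| + 1 := by
      have := Metric.mem_ball.1 hy
      rw [Real.dist_eq, sub_zero] at this
      exact this.le
    rw [Real.norm_eq_abs, abs_mul, abs_mul, abs_pow, Nat.abs_cast]
    gcongr
    exact hc k
  · simp [Metric.mem_ball]
    positivity
  · exact summable_powerSeries hc 0
  · simp [Metric.mem_ball]

/-- For `n ≥ 1` the series `φ_n` solves the initial value problem. -/
theorem isBesselSolution_besselPhi {n : ℕ} (hn : 1 ≤ n) : IsBesselSolution n (besselPhi n) := by
  have hn' : (1 : ℝ) ≤ n := by exact_mod_cast hn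
  let P : ℕ → ℝ := fun k => ∏ j ∈ Finset.Icc 1 k, (-2 * (j : ℝ)) * ((n : ℝ) - 2 + 2 * j)
  let c : ℕ → ℝ := fun k => 1 / P k
  have hP : ∀ k, P (k + 1) = P k * (-2 * ((k : ℝ) + 1) * (n + 2 * k)) := by
    intro k
    simp only [P]
    rw [Finset.prod_Icc_succ_top (by omega)]
    push_cast
    ring
  have hP0 : ∀ k, (k.factorial : ℝ) ≤ |P k| := by
    intro k
    induction k with
    | zero => simp [P]
    | succ k ih =>
      rw [hP, abs_mul, Nat.factorial_succ, mul_comm]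
      push_cast
      refine mul_le_mul ih ?_ (by positivity) (abs_nonneg _)
      rw [mul_assoc, neg_mul, abs_neg, abs_of_nonneg (by positivity)]
      nlinarith [Nat.cast_nonneg (α := ℝ) k]
  have hPne : ∀ k, P k ≠ 0 := fun k h => by
    have := hP0 k
    rw [h, abs_zero] at this
    exact absurd (Nat.cast_pos.2 k.factorial_pos) (not_lt.2 this)
  have hc : ∀ k, |c k| ≤ 1 / k.factorial := fun k => by
    simp only [c]
    rw [abs_div, abs_one]
    exact one_div_le_one_div_of_le (Nat.cast_pos.2 k.factorial_pos) (hP0 k)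
  have hrec : ∀ k : ℕ, 2 * ((k : ℝ) + 1) * (n + 2 * k) * c (k + 1) + c k = 0 := by
    intro k
    have h1 : (n : ℝ) + 2 * k ≠ 0 := by positivity
    have h2 := hPne k
    simp only [c, hP]
    field_simp
    ring
  let c1 : ℕ → ℝ := fun k => ((k : ℝ) + 1) * c (k + 1)
  let c2 : ℕ → ℝ := fun k => ((k : ℝ) + 1) * c1 (k + 1)
  have hc1 : ∀ k, |c1 k| ≤ 1 / k.factorial := coeff_deriv_le hc
  have hc2 : ∀ k, |c2 k| ≤ 1 / k.factorial := coeff_deriv_le hc1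
  let F : ℝ → ℝ := fun x => ∑' k, c k * x ^ k
  let F1 : ℝ → ℝ := fun x => ∑' k, c1 k * x ^ k
  let F2 : ℝ → ℝ := fun x => ∑' k, c2 k * x ^ k
  have hF : ∀ x, HasDerivAt F (F1 x) x := hasDerivAt_powerSeries hc
  have hF1 : ∀ x, HasDerivAt F1 (F2 x) x := hasDerivAt_powerSeries hc1
  have hF2 : ∀ x, HasDerivAt F2 _ x := hasDerivAt_powerSeries hc2
  have hφ : besselPhi n = fun r => F (r ^ 2) := by
    ext r
    refine tsum_congr fun k => ?_
    simp only [c, P, pow_mul]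
    ring
  have hsq : ∀ r : ℝ, HasDerivAt (fun r : ℝ => r ^ 2) (2 * r) r := fun r => by
    simpa using hasDerivAt_pow 2 r
  have hd1 : ∀ r, HasDerivAt (besselPhi n) (F1 (r ^ 2) * (2 * r)) r := fun r => by
    rw [hφ]
    exact (hF (r ^ 2)).comp r (hsq r)
  have hd1' : deriv (besselPhi n) = fun r => F1 (r ^ 2) * (2 * r) := funext fun r => (hd1 r).deriv
  have hd2 : ∀ r, HasDerivAt (deriv (besselPhi n))
      (F2 (r ^ 2) * (2 * r) * (2 * r) + F1 (r ^ 2) * 2) r := fun r => by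
    rw [hd1']
    have h2 : HasDerivAt (fun r : ℝ => 2 * r) 2 r := by simpa using (hasDerivAt_id r).const_mul 2
    exact ((hF1 (r ^ 2)).comp r (hsq r)).mul h2
  have hd2' : deriv (deriv (besselPhi n)) =
      fun r => F2 (r ^ 2) * (2 * r) * (2 * r) + F1 (r ^ 2) * 2 := funext fun r => (hd2 r).deriv
  have hcF1 : Continuous F1 := continuous_iff_continuousAt.2 fun x => (hF1 x).continuousAt
  have hcF2 : Continuous F2 := continuous_iff_continuousAt.2 fun x => (hF2 x).continuousAt
  have hODE : ∀ x, 4 * (x * F2 x) + 2 * n * F1 x + F x = 0 := by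
    intro x
    have s0 := summable_powerSeries hc x
    have s1 := summable_powerSeries hc1 x
    have s2 := summable_powerSeries hc2 x
    have e2 : HasSum (fun k : ℕ => ((k : ℝ) * c1 k) * x ^ k) (x * F2 x) := by
      rw [← hasSum_nat_add_iff' 1]
      simp only [Finset.range_one, Finset.sum_singleton, CharP.cast_eq_zero, zero_mul, sub_zero]
      have e3 : (fun k : ℕ => ((k + 1 : ℕ) : ℝ) * c1 (k + 1) * x ^ (k + 1)) =
          fun k => x * (c2 k * x ^ k) := by
        ext k
        simp only [c2]
        push_cast
        ring
      rw [e3]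
      exact s2.hasSum.mul_left x
    have e := ((e2.mul_left 4).add (s1.hasSum.mul_left (2 * (n : ℝ)))).add s0.hasSum
    refine e.unique ?_
    convert hasSum_zero using 1
    ext k
    have := hrec k
    simp only [c1]
    linear_combination x ^ k * this
  refine ⟨?_, ?_, ?_, ?_⟩
  · rw [show (2 : WithTop ℕ∞) = 1 + 1 by norm_num, contDiff_succ_iff_deriv]
    refine ⟨fun r => (hd1 r).differentiableAt, by simp, ?_⟩
    rw [contDiff_one_iff_deriv]
    refine ⟨fun r => (hd2 r).differentiableAt, ?_⟩
    rw [hd2']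
    fun_prop
  · rw [besselPhi, tsum_eq_single 0]
    · simp
    · intro k hk
      simp [hk]
  · rw [hd1']
    simp
  · intro r hr
    rw [hd2', hd1', hφ]
    have := hODE (r ^ 2)
    field_simp
    linear_combination this

/-- For `n ≥ 1` the function `φ_n` is the unique solution of the initial value problem. -/
theorem IsBesselSolution.eq_besselPhi {n : ℕ} (hn : 1 ≤ n) {φ : ℝ → ℝ}
    (hφ : IsBesselSolution n φ) : φ = besselPhi n := by
  have hn' : (1 : ℝ) ≤ n := by exact_mod_cast hn
  have hψ := isBesselSolution_besselPhi hn
  set ψ := besselPhi n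
  have hdiff : ∀ {f : ℝ → ℝ}, IsBesselSolution n f →
      (∀ r, HasDerivAt f (deriv f r) r) ∧ ∀ r, HasDerivAt (deriv f) (deriv (deriv f) r) r := by
    intro f hf
    have h := hf.contDiff
    rw [show (2 : WithTop ℕ∞) = 1 + 1 by norm_num, contDiff_succ_iff_deriv] at h
    exact ⟨fun r => (h.1 r).hasDerivAt,
      fun r => (h.2.2.differentiable (by simp) r).hasDerivAt⟩
  obtain ⟨a1, a2⟩ := hdiff hφ
  obtain ⟨b1, b2⟩ := hdiff hψ
  let E : ℝ → ℝ := fun r => (φ r - ψ r) ^ 2 + (deriv φ r - deriv ψ r) ^ 2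
  have hE : ∀ r, HasDerivAt E (2 * (φ r - ψ r) * (deriv φ r - deriv ψ r) +
      2 * (deriv φ r - deriv ψ r) * (deriv (deriv φ) r - deriv (deriv ψ) r)) r := fun r => by
    have h := (((a1 r).fun_sub (b1 r)).fun_pow 2).fun_add (((a2 r).fun_sub (b2 r)).fun_pow 2)
    have e : 2 * (φ r - ψ r) * (deriv φ r - deriv ψ r) +
        2 * (deriv φ r - deriv ψ r) * (deriv (deriv φ) r - deriv (deriv ψ) r) =
        ((2 : ℕ) : ℝ) * (φ r - ψ r) ^ (2 - 1) * (deriv φ r - deriv ψ r) +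
        ((2 : ℕ) : ℝ) * (deriv φ r - deriv ψ r) ^ (2 - 1) *
          (deriv (deriv φ) r - deriv (deriv ψ) r) := by
      norm_num
    rw [e]
    exact h
  have hE' : ∀ r, r ≠ 0 →
      deriv E r = -(2 * (n - 1) * (deriv φ r - deriv ψ r) ^ 2) / r := fun r hr => by
    rw [(hE r).deriv]
    have h1 : deriv (deriv φ) r = -((n - 1) * (deriv φ r / r) + φ r) := by
      linear_combination hφ.ode r hr
    have h2 : deriv (deriv ψ) r = -((n - 1) * (deriv ψ r / r) + ψ r) := by
      linear_combination hψ.ode r hr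
    rw [h1, h2]
    field_simp
    ring
  have hcont : Continuous E := continuous_iff_continuousAt.2 fun r => (hE r).continuousAt
  have hE0 : E 0 = 0 := by simp [E, hφ.map_zero, hψ.map_zero, hφ.deriv_zero, hψ.deriv_zero]
  have hnum : ∀ r, 0 ≤ 2 * ((n : ℝ) - 1) * (deriv φ r - deriv ψ r) ^ 2 := fun r =>
    mul_nonneg (by linarith) (sq_nonneg _)
  have hle : ∀ r, E r ≤ 0 := by
    intro r
    rcases le_total 0 r with hr | hr
    · have := antitoneOn_of_deriv_nonpos (convex_Ici 0) hcont.continuousOn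
        (fun x _ => (hE x).differentiableAt.differentiableWithinAt) (fun x hx => by
          rw [interior_Ici] at hx
          rw [hE' x hx.ne']
          exact div_nonpos_of_nonpos_of_nonneg (neg_nonpos.2 (hnum x)) hx.le)
        (Set.mem_Ici.2 le_rfl) (Set.mem_Ici.2 hr) hr
      rwa [hE0] at this
    · have := monotoneOn_of_deriv_nonneg (convex_Iic 0) hcont.continuousOn
        (fun x _ => (hE x).differentiableAt.differentiableWithinAt) (fun x hx => by
          rw [interior_Iic] at hx
          rw [hE' x hx.ne]
          exact div_nonneg_of_nonpos (neg_nonpos.2 (hnum x)) hx.le)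
        (Set.mem_Iic.2 hr) (Set.mem_Iic.2 le_rfl) hr
      rwa [hE0] at this
  ext r
  have h := hle r
  simp only [E] at h
  have : (φ r - ψ r) ^ 2 = 0 := by nlinarith [sq_nonneg (φ r - ψ r), sq_nonneg (deriv φ r - deriv ψ r)]
  exact sub_eq_zero.1 (pow_eq_zero_iff (by norm_num) |>.1 this)

/-- `T` is the deformed exterior derivative `d_t = t φ_{q+2}(tD) d`, as a bounded operator on the
Hilbert space of square integrable forms on `ℝ^q`: it is the bounded extension of the operator
`ω ↦ t φ_{q+2}(tD) dω` from the dense domain of rapidly decreasing smooth forms `ω`. -/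
def IsDeformedExtD {q : ℕ} (t : ℝ) (T : FormL2 q →L[ℂ] FormL2 q) : Prop :=
  ∃ Φ : FormL2 q →L[ℂ] FormL2 q, IsFunctionOfDirac (fun r => besselPhi (q + 2) (t * r)) Φ ∧
    ∀ ω : 𝓢(Space q, FormFiber q), T (ω.toLp 2) = (t : ℂ) • Φ ((extD ω).toLp 2)

/-- The form `u` is the image of `f` under the extension of the bounded operator `T` to forms `f`
which need not be square integrable, in the sense of distributions (currents): for each smooth
compactly supported test form `ψ`, one has `⟨T* ψ, f⟩ = ⟨ψ, u⟩`, where the integral on the left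
converges absolutely. -/
def IsDistributionalImage {q : ℕ} (T : FormL2 q →L[ℂ] FormL2 q) (f u : Space q → FormFiber q) :
    Prop :=
  ∀ ψ : 𝓢(Space q, FormFiber q), HasCompactSupport ψ →
    Integrable (fun x => inner ℂ (ContinuousLinearMap.adjoint T (ψ.toLp 2) x) (f x)) ∧
    ∫ x, inner ℂ (ContinuousLinearMap.adjoint T (ψ.toLp 2) x) (f x) = ∫ x, inner ℂ (ψ x) (u x)

/-! ### Alternating forms, wave fronts and flux -/

/-- The coordinates of an alternating `k`-form in the basis `dx_I`: the coefficient of `dx_I`, where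
`I = {i₁ < … < iₖ}`, is the value of the form on `(e_{i₁}, …, e_{iₖ})`. -/
noncomputable def formCoords {q k : ℕ} :
    (Space q [⋀^Fin k]→L[ℝ] ℂ) →L[ℝ] FormFiber q :=
  (PiLp.continuousLinearEquiv 2 ℝ fun _ : Finset (Fin q) => ℂ).symm.toContinuousLinearMap.comp
    (ContinuousLinearMap.pi fun I : Finset (Fin q) =>
      if h : I.card = k then
        ContinuousAlternatingMap.apply ℝ (Space q) ℂ fun j => stdVec (I.orderEmbOfFin h j)
      else 0)

theorem formCoords_apply {q k : ℕ} (α : Space q [⋀^Fin k]→L[ℝ] ℂ) (I : Finset (Fin q)) :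
    formCoords α I =
      if h : I.card = k then α fun j => stdVec (I.orderEmbOfFin h j) else 0 := by
  change (ContinuousLinearMap.pi fun I : Finset (Fin q) =>
      if h : I.card = k then
        ContinuousAlternatingMap.apply ℝ (Space q) ℂ fun j => stdVec (I.orderEmbOfFin h j)
      else 0) α I = _
  rw [ContinuousLinearMap.pi_apply]
  by_cases h : I.card = k
  · rw [dif_pos h, dif_pos h]
    rfl
  · rw [dif_neg h, dif_neg h]
    rfl

/-- In these coordinates the exterior derivative is `∑ᵢ dx_i ∧ ∂ᵢ`. -/
theorem formCoords_extDeriv {q k : ℕ} (f : Space q → Space q [⋀^Fin k]→L[ℝ] ℂ) (x : Space q)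
    (hf : DifferentiableAt ℝ f x) :
    formCoords (extDeriv f x) =
      ∑ i, wedge i (fderiv ℝ (fun y => formCoords (f y)) x (stdVec i)) := by
  have hfd : ∀ v, fderiv ℝ (fun y => formCoords (f y)) x v = formCoords (fderiv ℝ f x v) := by
    intro v
    have h := (formCoords (q := q) (k := k)).hasFDerivAt.comp x hf.hasFDerivAt
    have h' : fderiv ℝ (fun y => formCoords (f y)) x = _ := h.fderiv
    rw [h']
    rfl
  have hw : ∀ (i : Fin q) (η : FormFiber q) (I : Finset (Fin q)), wedge i η I =
      if i ∈ I then (-1 : ℂ) ^ (I.filter (· < i)).card * η (I.erase i) else 0 :=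
    fun _ _ _ => rfl
  ext I
  simp only [hfd, WithLp.ofLp_sum, Finset.sum_apply, hw]
  rw [← Finset.sum_filter, Finset.filter_mem_eq_inter, Finset.univ_inter]
  rw [formCoords_apply]
  split_ifs with hI
  · rw [extDeriv, ContinuousAlternatingMap.alternatizeUncurryFin_apply]
    refine Finset.sum_bij (fun j _ => I.orderEmbOfFin hI j) ?_ ?_ ?_ ?_
    · exact fun j _ => Finset.orderEmbOfFin_mem I hI j
    · exact fun a _ b _ h => (I.orderEmbOfFin hI).injective h
    · intro i hi
      have : i ∈ Set.range (I.orderEmbOfFin hI) := by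
        rw [Finset.range_orderEmbOfFin]
        exact hi
      obtain ⟨j, rfl⟩ := this
      exact ⟨j, Finset.mem_univ _, rfl⟩
    · intro j _
      have hmem := Finset.orderEmbOfFin_mem I hI j
      have hcard : (I.erase (I.orderEmbOfFin hI j)).card = k := by
        rw [Finset.card_erase_of_mem hmem, hI, Nat.add_sub_cancel]
      have hfilt : (I.filter (· < I.orderEmbOfFin hI j)).card = j := by
        have : I.filter (· < I.orderEmbOfFin hI j) =
            (Finset.Iio j).map (I.orderEmbOfFin hI).toEmbedding := by
          ext i
          simp only [Finset.mem_filter, Finset.mem_map, Finset.mem_Iio, RelEmbedding.coe_toEmbedding]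
          constructor
          · rintro ⟨hi, hlt⟩
            have : i ∈ Set.range (I.orderEmbOfFin hI) := by
              rw [Finset.range_orderEmbOfFin]
              exact hi
            obtain ⟨l, rfl⟩ := this
            exact ⟨l, (I.orderEmbOfFin hI).lt_iff_lt.1 hlt, rfl⟩
          · rintro ⟨l, hl, rfl⟩
            exact ⟨Finset.orderEmbOfFin_mem I hI l, (I.orderEmbOfFin hI).lt_iff_lt.2 hl⟩
        rw [this, Finset.card_map, Fin.card_Iio]
      have hu : (fun l : Fin k => I.orderEmbOfFin hI (j.succAbove l)) =
          (I.erase (I.orderEmbOfFin hI j)).orderEmbOfFin hcard := by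
        refine Finset.orderEmbOfFin_unique hcard (fun l => ?_) ?_
        · rw [Finset.mem_erase]
          exact ⟨fun h => Fin.succAbove_ne j l ((I.orderEmbOfFin hI).injective h),
            Finset.orderEmbOfFin_mem I hI _⟩
        · exact (I.orderEmbOfFin hI).strictMono.comp (Fin.strictMono_succAbove j)
      rw [hfilt, formCoords_apply, dif_pos hcard, ← hu]
      rw [zsmul_eq_mul]
      push_cast
      rfl
  · refine (Finset.sum_eq_zero fun i hi => ?_).symm
    rw [formCoords_apply, dif_neg, mul_zero]
    rw [Finset.card_erase_of_mem hi]
    have : 0 < I.card := Finset.card_pos.2 ⟨i, hi⟩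
    omega

/-- The volume form `c dx_1 ∧ … ∧ dx_q`. -/
noncomputable def volForm {q : ℕ} (c : ℂ) : FormFiber q := EuclideanSpace.single Finset.univ c

/-- The surface measure on the wave front `W_t(p) = {p + t v : |v| = 1}` in `ℝ^{n+1}`: the image of
the surface measure on the unit sphere, scaled by `tⁿ`. -/
noncomputable def waveFrontMeasure {n : ℕ} (t : ℝ) (p : Space (n + 1)) : Measure (Space (n + 1)) :=
  ENNReal.ofReal (t ^ n) •
    Measure.map (fun v : Metric.sphere (0 : Space (n + 1)) 1 => p + t • (v : Space (n + 1)))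
      (Measure.toSphere volume)

/-- The density, with respect to surface measure, of the restriction of the `n`-form `α` on
`ℝ^{n+1}` to an oriented hypersurface with unit normal `ν`: the coefficient of the volume form in
`ν♭ ∧ α`. -/
noncomputable def fluxDensity {n : ℕ} (ν : Space (n + 1))
    (α : Space (n + 1) [⋀^Fin n]→L[ℝ] ℂ) : ℂ :=
  ContinuousAlternatingMap.alternatizeUncurryFin ((innerSL ℝ ν).smulRight α) stdVec

/-- The flux density is the value of the form on each positively oriented orthonormal basis of the
tangent space (outward normal first). -/
theorem fluxDensity_eq {n : ℕ} (b : OrthonormalBasis (Fin (n + 1)) ℝ (Space (n + 1)))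
    (hb : b.toBasis.orientation =
      (EuclideanSpace.basisFun (Fin (n + 1)) ℝ).toBasis.orientation)
    (α : Space (n + 1) [⋀^Fin n]→L[ℝ] ℂ) :
    fluxDensity (b 0) α = α fun j => b j.succ := by
  have key : ∀ g : Space (n + 1) [⋀^Fin (n + 1)]→ₗ[ℝ] ℝ, g stdVec = g b := by
    intro g
    rw [AlternatingMap.eq_smul_basis_det b.toBasis g]
    have h := b.det_to_matrix_orthonormalBasis_of_same_orientation
      (EuclideanSpace.basisFun (Fin (n + 1)) ℝ) hb
    have h2 := b.toBasis.det_self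
    have e : (stdVec : Fin (n + 1) → Space (n + 1)) =
        EuclideanSpace.basisFun (Fin (n + 1)) ℝ := by
      ext i
      simp
    rw [OrthonormalBasis.coe_toBasis] at h2
    rw [AlternatingMap.smul_apply, AlternatingMap.smul_apply, e, h, h2]
  let A := ContinuousAlternatingMap.alternatizeUncurryFin ((innerSL ℝ (b 0)).smulRight α)
  have hA : A stdVec = A b := by
    apply Complex.ext
    · exact key (Complex.reLm.compAlternatingMap A.toAlternatingMap)
    · exact key (Complex.imLm.compAlternatingMap A.toAlternatingMap)
  change A stdVec = _
  rw [hA, ContinuousAlternatingMap.alternatizeUncurryFin_apply, Finset.sum_eq_single 0]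
  · simp
    rfl
  · intro i _ hi
    have : inner ℝ (b 0) (b i) = 0 := b.orthonormal.2 hi.symm
    simp [this]
  · simp

/-- The flux `∫_{W_t(p)} f` of an `n`-form `f` on `ℝ^{n+1}` through the wave front `W_t(p)`, oriented
by the outward unit normal. -/
noncomputable def flux {n : ℕ} (f : Space (n + 1) → Space (n + 1) [⋀^Fin n]→L[ℝ] ℂ) (t : ℝ)
    (p : Space (n + 1)) : ℂ :=
  ∫ x, fluxDensity (t⁻¹ • (x - p)) (f x) ∂(waveFrontMeasure t p)

/-- The average flux `|W_t(p)|⁻¹ ∫_{W_t(p)} f`. -/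
noncomputable def averageFlux {n : ℕ} (f : Space (n + 1) → Space (n + 1) [⋀^Fin n]→L[ℝ] ℂ) (t : ℝ)
    (p : Space (n + 1)) : ℂ :=
  ((waveFrontMeasure t p).real Set.univ : ℂ)⁻¹ * flux f t p

/-! The operator `t φ_{q+2}(tD) d` is the Fourier multiplier with symbol
`t φ_{q+2}(2πt|ξ|) · 2πi ξ♭ ∧ ·`, because `D²` has symbol `(2π|ξ|)²` and `φ_{q+2}` is even.  This
symbol is the inverse Fourier transform of `q ν♭ ∧ ·` times the normalized surface measure of the
sphere of radius `t`, where `ν` is the normal: on a rotation invariant average of the plane waves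
`exp (i⟨ξ, v⟩)` the equation `Δ w = -w` is the Bessel equation.  Hence `d_t` is an average of
translates, `d_t f (p) = q ⨍ ν♭ ∧ f (p + t ν)`, and on a `(q-1)`-form `ν♭ ∧ f` is the flux density
of `f` times the volume form.  The adjoint is the average over the opposite translates, so it
preserves compact support; this gives the distributional statement for all continuous `f`. -/

section Bessel

variable {n : ℕ}

/-- The coefficient of `r ^ (2 * k)` in the power series of `besselPhi n`. -/
noncomputable def besselCoeff (n k : ℕ) : ℝ :=
  (∏ j ∈ Finset.Icc 1 k, (-2 * (j : ℝ)) * ((n : ℝ) - 2 + 2 * j))⁻¹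

theorem besselCoeff_zero (n : ℕ) : besselCoeff n 0 = 1 := by
  simp [besselCoeff]

theorem besselCoeff_succ (n k : ℕ) :
    besselCoeff n (k + 1) = besselCoeff n k * ((-2 * ((k : ℝ) + 1)) * (n + 2 * k))⁻¹ := by
  rw [besselCoeff, besselCoeff, Finset.prod_Icc_succ_top (by lia), mul_inv]
  push_cast
  ring

theorem besselPhi_eq_tsum (n : ℕ) (r : ℝ) :
    besselPhi n r = ∑' k, besselCoeff n k * (r ^ 2) ^ k := by
  refine tsum_congr fun k => ?_
  rw [besselCoeff, pow_mul, div_eq_inv_mul]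

theorem abs_besselCoeff_le (hn : 1 ≤ n) (k : ℕ) : |besselCoeff n k| ≤ 1 / k.factorial := by
  have hn' : (1 : ℝ) ≤ n := by exact_mod_cast hn
  induction k with
  | zero => simp [besselCoeff_zero]
  | succ k ih =>
    have hfactor : |((-2 * ((k : ℝ) + 1)) * (n + 2 * k))⁻¹| ≤ 1 / (k + 1) := by
      rw [abs_inv, neg_mul, neg_mul, abs_neg, abs_of_nonneg (by positivity), ← one_div]
      gcongr
      nlinarith [Nat.cast_nonneg (α := ℝ) k]
    rw [besselCoeff_succ, abs_mul]
    calc _ ≤ 1 / (k.factorial : ℝ) * (1 / (k + 1)) := by gcongr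
      _ = 1 / (k + 1).factorial := by
        rw [Nat.factorial_succ]
        push_cast
        field_simp

theorem succ_mul_besselCoeff_succ (hn : 1 ≤ n) (k : ℕ) :
    ((k : ℝ) + 1) * besselCoeff n (k + 1) = -(1 / (2 * n)) * besselCoeff (n + 2) k := by
  have hn' : (n : ℝ) ≠ 0 := by positivity
  induction k with
  | zero =>
    rw [besselCoeff_succ, besselCoeff_zero, besselCoeff_zero]
    field_simp
    simp
  | succ k ih =>
    rw [besselCoeff_succ, besselCoeff_succ (n + 2), ← mul_assoc _ (besselCoeff (n + 2) k), ← ih]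
    have : (n : ℝ) + 2 * (k + 1) ≠ 0 := by positivity
    push_cast
    field_simp
    ring

theorem hasDerivAt_besselPhi_norm {V : Type*} [NormedAddCommGroup V] [InnerProductSpace ℝ V]
    (hn : 1 ≤ n) {f : ℝ → V} {f' : V} {s : ℝ} (hf : HasDerivAt f f' s) :
    HasDerivAt (fun s => besselPhi n ‖f s‖)
      (-(inner ℝ (f s) f' / n) * besselPhi (n + 2) ‖f s‖) s := by
  have hn' : (n : ℝ) ≠ 0 := by positivity
  have h := (hasDerivAt_powerSeries (abs_besselCoeff_le hn) (‖f s‖ ^ 2)).comp s hf.norm_sq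
  simp only [succ_mul_besselCoeff_succ hn, mul_assoc, tsum_mul_left] at h
  refine (h.congr_of_eventuallyEq
    (.of_forall fun s => besselPhi_eq_tsum n ‖f s‖)).congr_deriv ?_
  rw [besselPhi_eq_tsum]
  field_simp

theorem continuous_besselPhi (hn : 1 ≤ n) : Continuous (besselPhi n) :=
  (isBesselSolution_besselPhi hn).contDiff.continuous

theorem even_besselPhi (n : ℕ) : Function.Even (besselPhi n) := fun r => by
  rw [besselPhi_eq_tsum, besselPhi_eq_tsum, neg_sq]

theorem IsBesselSolution.of_hasDerivAt {φ φ' φ'' : ℝ → ℝ} (hφ : ∀ r, HasDerivAt φ (φ' r) r)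
    (hφ' : ∀ r, HasDerivAt φ' (φ'' r) r) (hcont : Continuous φ'') (h0 : φ 0 = 1) (h0' : φ' 0 = 0)
    (hode : ∀ r, r ^ 2 * φ'' r + (n - 1) * (r * φ' r) + r ^ 2 * φ r = 0) :
    IsBesselSolution n φ := by
  have hd : deriv φ = φ' := funext fun r => (hφ r).deriv
  have hd' : deriv φ' = φ'' := funext fun r => (hφ' r).deriv
  have hC1 : ContDiff ℝ 1 φ' :=
    contDiff_one_iff_deriv.2 ⟨fun r => (hφ' r).differentiableAt, hd' ▸ hcont⟩
  have hC2 : ContDiff ℝ (1 + 1) φ :=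
    contDiff_succ_iff_deriv.2 ⟨fun r => (hφ r).differentiableAt, by simp, hd ▸ hC1⟩
  refine ⟨by simpa [one_add_one_eq_two] using hC2, h0, by rw [hd, h0'], fun r hr => ?_⟩
  rw [hd, hd']
  refine mul_left_cancel₀ (pow_ne_zero 2 hr) ?_
  rw [mul_zero, ← hode r]
  field_simp

end Bessel

section CompactSpace

variable {Y E : Type*} [TopologicalSpace Y] [CompactSpace Y] [MeasurableSpace Y]
  [OpensMeasurableSpace Y] [NormedAddCommGroup E] (μ : Measure Y) [IsFiniteMeasure μ]

theorem integrable_of_compactSpace {f : Y → E} (hf : Continuous f) : Integrable f μ :=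
  hf.integrable_of_hasCompactSupport (HasCompactSupport.of_compactSpace f)

variable [SecondCountableTopologyEither Y E] [NormedSpace ℝ E]

theorem continuous_integral_of_compactSpace {X : Type*} [TopologicalSpace X]
    [FirstCountableTopology X] [LocallyCompactSpace X] {f : X → Y → E}
    (hf : Continuous (Function.uncurry f)) : Continuous fun x => ∫ y, f x y ∂μ := by
  simpa only [Measure.restrict_univ] using
    continuous_parametric_integral_of_continuous (μ := μ) hf isCompact_univ

theorem hasDerivAt_integral_of_compactSpace {f f' : ℝ → Y → E} (hf : ∀ s, Continuous (f s))
    (hf' : Continuous (Function.uncurry f')) (h : ∀ s y, HasDerivAt (f · y) (f' s y) s) (s : ℝ) :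
    HasDerivAt (fun s => ∫ y, f s y ∂μ) (∫ y, f' s y ∂μ) s := by
  obtain ⟨C, hC⟩ := ((isCompact_closedBall s 1).prod
    (isCompact_univ (X := Y))).exists_bound_of_continuousOn hf'.continuousOn
  refine (hasDerivAt_integral_of_dominated_loc_of_deriv_le (bound := fun _ => C)
    (Metric.closedBall_mem_nhds s one_pos) (.of_forall fun s => (hf s).aestronglyMeasurable)
    (integrable_of_compactSpace μ (hf s)) ?_ (.of_forall fun y s hs => ?_) (integrable_const C)
    (.of_forall fun y s _ => h s y)).2
  · exact (hf'.comp (Continuous.prodMk_right s)).aestronglyMeasurable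
  · exact hC (s, y) ⟨hs, Set.mem_univ _⟩

end CompactSpace

section Sphere

variable {V : Type*} [NormedAddCommGroup V] [InnerProductSpace ℝ V] [FiniteDimensional ℝ V]
  [MeasurableSpace V] [BorelSpace V]

variable (V) in
/-- The surface measure on the unit sphere of `V`, normalized to total mass one. -/
noncomputable def sphereProb : Measure (Metric.sphere (0 : V) 1) :=
  (Measure.toSphere (volume : Measure V) Set.univ)⁻¹ • Measure.toSphere volume

instance [Nontrivial V] : IsProbabilityMeasure (sphereProb V) :=
  have : NeZero (Measure.toSphere (volume : Measure V)) := ⟨Measure.toSphere_ne_zero _⟩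
  isProbabilityMeasureSMul

/-- The homeomorphism of the unit sphere induced by a linear isometry. -/
def sphereHomeomorph (R : V ≃ₗᵢ[ℝ] V) : Metric.sphere (0 : V) 1 ≃ₜ Metric.sphere (0 : V) 1 :=
  R.toHomeomorph.subtype fun v => by simp

open scoped Pointwise in
theorem measurePreserving_sphereHomeomorph (R : V ≃ₗᵢ[ℝ] V) :
    MeasurePreserving (sphereHomeomorph R) (Measure.toSphere (volume : Measure V))
      (Measure.toSphere volume) := by
  have hmeas : Measurable (sphereHomeomorph R) := (sphereHomeomorph R).continuous.measurable
  refine ⟨hmeas, Measure.ext fun s hs => ?_⟩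
  rw [Measure.map_apply hmeas hs, Measure.toSphere_apply' _ hs,
    Measure.toSphere_apply' _ (hmeas hs)]
  have himage : Subtype.val '' (sphereHomeomorph R ⁻¹' s) = R ⁻¹' (Subtype.val '' s) := by
    ext v
    simp only [Set.mem_image, Set.mem_preimage, Subtype.exists, exists_and_right, exists_eq_right,
      mem_sphere_zero_iff_norm, R.norm_map]
    rfl
  have hcone : Set.Ioo (0 : ℝ) 1 • (R ⁻¹' (Subtype.val '' s)) =
      R ⁻¹' (Set.Ioo (0 : ℝ) 1 • (Subtype.val '' s)) := by
    rw [← R.symm_symm, ← R.symm.image_eq_preimage_symm, ← R.symm.image_eq_preimage_symm]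
    exact (Set.image_image2_distrib_right fun a b => R.symm.map_smul a b).symm
  rw [himage, hcone]
  congr 1
  exact R.measurePreserving.measure_preimage_equiv (f := R.toHomeomorph.toMeasurableEquiv) _

variable {E : Type*} [NormedAddCommGroup E] [NormedSpace ℝ E]

theorem integral_sphereProb_comp_isometry (R : V ≃ₗᵢ[ℝ] V) (g : V → E) :
    ∫ v, g (R v) ∂sphereProb V = ∫ v, g v ∂sphereProb V := by
  rw [sphereProb, integral_smul_measure, integral_smul_measure]
  congr 1
  exact (measurePreserving_sphereHomeomorph R).integral_comp
    (sphereHomeomorph R).measurableEmbedding (fun v => g v)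

theorem integral_sphereProb_eq_zero_of_odd {g : V → E} (hg : Function.Odd g) :
    ∫ v, g v ∂sphereProb V = 0 := by
  have h := integral_sphereProb_comp_isometry (LinearIsometryEquiv.neg ℝ) g
  simp only [LinearIsometryEquiv.coe_neg, hg _, integral_neg] at h
  have : IsAddTorsionFree E := .of_isTorsionFree ℝ E
  exact self_eq_neg.1 h.symm

/- The integral of `g` over the sphere does not change when `g` is composed with the rotations
`exp (s A)`; the derivative in `s` at `0` is the assertion. -/
open NormedSpace in
theorem integral_sphereProb_fderiv_skewAdjoint [Nontrivial V] {g : V → E} (hg : ContDiff ℝ 1 g)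
    {A : V →L[ℝ] V} (hA : A ∈ skewAdjoint (V →L[ℝ] V)) :
    ∫ v, fderiv ℝ g v (A v) ∂sphereProb V = 0 := by
  obtain ⟨U, hU, hU0, hU'⟩ : ∃ U : ℝ → V →L[ℝ] V, (∀ s, U s ∈ unitary (V →L[ℝ] V)) ∧ U 0 = 1 ∧
      ∀ s, HasDerivAt U (A * U s) s := by
    let _ := NormedAlgebra.restrictScalars ℚ ℝ (V →L[ℝ] V)
    exact ⟨fun s => exp (s • A),
      fun s => exp_mem_unitary_of_mem_skewAdjoint (skewAdjoint.smul_mem s hA),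
      by simp, hasDerivAt_exp_smul_const' A⟩
  have hconst : ∀ s, ∫ v : Metric.sphere (0 : V) 1, g (U s v) ∂sphereProb V =
      ∫ v, g v ∂sphereProb V := fun s =>
    integral_sphereProb_comp_isometry (Unitary.linearIsometryEquiv ⟨U s, hU s⟩) g
  have hUcont : Continuous U := continuous_iff_continuousAt.2 fun s => (hU' s).continuousAt
  have hderiv := hasDerivAt_integral_of_compactSpace (sphereProb V)
    (f := fun s v => g (U s v)) (f' := fun s v => fderiv ℝ g (U s v) (A (U s v)))
    (fun s => hg.continuous.comp (by fun_prop))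
    (((hg.continuous_fderiv one_ne_zero).comp (by fun_prop)).clm_apply (by fun_prop))
    (fun s v => (hg.differentiable one_ne_zero _).hasFDerivAt.comp_hasDerivAt s
      ((ContinuousLinearMap.apply ℝ V (v : V)).hasFDerivAt.comp_hasDerivAt s (hU' s))) 0
  simp only [hconst, hU0] at hderiv
  exact hderiv.unique (hasDerivAt_const _ _)

end Sphere

section SphereIntegrals

open Module (finrank)
open Metric (sphere)

variable {V : Type*} [NormedAddCommGroup V] [InnerProductSpace ℝ V] [FiniteDimensional ℝ V]
  [MeasurableSpace V] [BorelSpace V] [Nontrivial V]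

theorem integral_sphereProb_rotation (ξ η : V) :
    ∫ v : sphere (0 : V) 1,
      ((inner ℝ ξ v * inner ℝ η η - inner ℝ η v * inner ℝ ξ η) * Real.sin (inner ℝ ξ v) +
        (inner ℝ ξ v * inner ℝ η v * inner ℝ ξ η - inner ℝ η v ^ 2 * inner ℝ ξ ξ) *
          Real.cos (inner ℝ ξ v)) ∂sphereProb V = 0 := by
  let A := InnerProductSpace.rankOne ℝ η ξ - InnerProductSpace.rankOne ℝ ξ η
  have hA : A ∈ skewAdjoint (V →L[ℝ] V) := by
    simp [A, skewAdjoint.mem_iff, ContinuousLinearMap.star_eq_adjoint]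
  rw [← integral_sphereProb_fderiv_skewAdjoint
    ((innerSL ℝ η).contDiff.mul (Real.contDiff_sin.comp (innerSL ℝ ξ).contDiff)) hA]
  congr 1
  ext v
  have hderiv : HasFDerivAt (fun v => innerSL ℝ η v * Real.sin (innerSL ℝ ξ v)) _ (v : V) :=
    (innerSL ℝ η).hasFDerivAt.mul (innerSL ℝ ξ).hasFDerivAt.sin
  change _ = fderiv ℝ (fun v => innerSL ℝ η v * Real.sin (innerSL ℝ ξ v)) v (A v)
  rw [hderiv.fderiv]
  simp only [A, _root_.add_apply, _root_.sub_apply, _root_.smul_apply, innerSL_apply_apply,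
    smul_eq_mul, InnerProductSpace.rankOne_apply, inner_sub_right, inner_smul_right,
    real_inner_comm ξ η]
  ring

theorem finrank_sub_one_mul_integral_sphereProb_mul_sin (ξ : V) :
    (finrank ℝ V - 1) *
        ∫ v : sphere (0 : V) 1, inner ℝ ξ v * Real.sin (inner ℝ ξ v) ∂sphereProb V =
      ∫ v : sphere (0 : V) 1, (‖ξ‖ ^ 2 - inner ℝ ξ v ^ 2) * Real.cos (inner ℝ ξ v)
        ∂sphereProb V := by
  let b := stdOrthonormalBasis ℝ V
  have h := Finset.sum_eq_zero fun i (_ : i ∈ Finset.univ) => integral_sphereProb_rotation ξ (b i)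
  rw [← integral_finsetSum _ fun i _ => integrable_of_compactSpace _ (by fun_prop)] at h
  rw [← integral_const_mul, ← sub_eq_zero, ← integral_sub
    (integrable_of_compactSpace _ (by fun_prop)) (integrable_of_compactSpace _ (by fun_prop)), ← h]
  congr 1
  ext v
  have hsum : ∑ i, inner ℝ (b i) v * inner ℝ ξ (b i) = inner ℝ ξ v := by
    simpa only [mul_comm] using b.sum_inner_mul_inner ξ v
  have hsq : ∑ i, inner ℝ (b i) (v : V) ^ 2 = 1 := by
    rw [b.sum_sq_inner_right, norm_eq_of_mem_sphere, one_pow]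
  have hb : ∀ i, inner ℝ (b i) (b i) = 1 := fun i => by simp
  simp only [hb, Finset.sum_add_distrib, ← Finset.sum_mul, Finset.sum_sub_distrib, mul_one,
    mul_assoc, ← Finset.mul_sum, hsum, hsq, Finset.sum_const, Finset.card_univ, Fintype.card_fin,
    nsmul_eq_mul, real_inner_self_eq_norm_sq]
  ring

theorem isBesselSolution_integral_sphereProb_cos {e : V} (he : ‖e‖ = 1) :
    IsBesselSolution (finrank ℝ V)
      fun r => ∫ v : sphere (0 : V) 1, Real.cos (r * inner ℝ e v) ∂sphereProb V := by
  refine .of_hasDerivAt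
    (φ' := fun r => ∫ v : sphere (0 : V) 1, -(inner ℝ e v * Real.sin (r * inner ℝ e v))
      ∂sphereProb V)
    (φ'' := fun r => ∫ v : sphere (0 : V) 1, -(inner ℝ e v ^ 2 * Real.cos (r * inner ℝ e v))
      ∂sphereProb V)
    (hasDerivAt_integral_of_compactSpace _ (fun r => by fun_prop) (by fun_prop) fun r v => ?_)
    (hasDerivAt_integral_of_compactSpace _ (fun r => by fun_prop) (by fun_prop) fun r v => ?_)
    (continuous_integral_of_compactSpace _ (by fun_prop)) (by simp) (by simp) fun r => ?_
  · exact (hasDerivAt_mul_const (inner ℝ e (v : V))).cos.congr_deriv (by ring)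
  · exact ((hasDerivAt_mul_const (inner ℝ e (v : V))).sin.const_mul _).neg.congr_deriv (by ring)
  · have h := finrank_sub_one_mul_integral_sphereProb_mul_sin (r • e)
    simp only [real_inner_smul_left, norm_smul, he, mul_one, Real.norm_eq_abs, sq_abs, sub_mul,
      mul_pow] at h
    rw [integral_sub (integrable_of_compactSpace _ (by fun_prop))
      (integrable_of_compactSpace _ (by fun_prop))] at h
    simp only [mul_assoc, integral_const_mul] at h
    rw [integral_neg, integral_neg]
    linear_combination -h

theorem integral_sphereProb_cos (ξ : V) :
    ∫ v : sphere (0 : V) 1, Real.cos (inner ℝ ξ v) ∂sphereProb V = besselPhi (finrank ℝ V) ‖ξ‖ := by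
  obtain ⟨e, he, hξ⟩ : ∃ e : V, ‖e‖ = 1 ∧ ξ = ‖ξ‖ • e := by
    rcases eq_or_ne ξ 0 with rfl | hξ
    · obtain ⟨e, he⟩ := exists_norm_eq V zero_le_one
      exact ⟨e, he, by simp⟩
    · exact ⟨‖ξ‖⁻¹ • ξ, norm_smul_inv_norm hξ, by simp [smul_smul, hξ]⟩
  have hbessel := (isBesselSolution_integral_sphereProb_cos he).eq_besselPhi Module.finrank_pos
  rw [← hbessel]
  nth_rw 1 [hξ]
  simp only [real_inner_smul_left]

theorem integral_sphereProb_inner_mul_sin (ξ η : V) :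
    ∫ v : sphere (0 : V) 1, inner ℝ η v * Real.sin (inner ℝ ξ v) ∂sphereProb V =
      inner ℝ ξ η / finrank ℝ V * besselPhi (finrank ℝ V + 2) ‖ξ‖ := by
  have hline : HasDerivAt (fun s : ℝ => ξ + s • η) η 0 := by
    simpa using ((hasDerivAt_id (0 : ℝ)).smul_const η).const_add ξ
  have hbessel := hasDerivAt_besselPhi_norm (Module.finrank_pos (R := ℝ) (M := V)) hline
  have hint := hasDerivAt_integral_of_compactSpace (sphereProb V)
    (f := fun s v => Real.cos (inner ℝ (ξ + s • η) v))
    (f' := fun s v => -(inner ℝ η v * Real.sin (inner ℝ (ξ + s • η) v)))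
    (fun s => by fun_prop) (by fun_prop) ?_ 0
  · simp only [integral_sphereProb_cos] at hint
    have h := hint.unique hbessel
    simp only [integral_neg, zero_smul, add_zero] at h
    linear_combination -h
  · intro s v
    have h : HasDerivAt (fun s : ℝ => inner ℝ ξ (v : V) + s * inner ℝ η v) (inner ℝ η v) s :=
      (hasDerivAt_mul_const _).const_add _
    simp only [inner_add_left, real_inner_smul_left]
    exact h.cos.congr_deriv (by ring)

theorem abs_besselPhi_le_one {n : ℕ} (hn : 1 ≤ n) (r : ℝ) : |besselPhi n r| ≤ 1 := by
  have : Nonempty (Fin n) := ⟨⟨0, hn⟩⟩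
  obtain ⟨ξ, hξ⟩ := exists_norm_eq (Space n) (abs_nonneg r)
  have hbound := norm_integral_le_of_norm_le_const (μ := sphereProb (Space n)) (C := 1)
    (f := fun v => Real.cos (inner ℝ ξ v)) (.of_forall fun v => Real.abs_cos_le_one _)
  rw [integral_sphereProb_cos, hξ, finrank_euclideanSpace_fin, probReal_univ, mul_one] at hbound
  rcases abs_choice r with h | h
  · rwa [h] at hbound
  · rwa [h, even_besselPhi] at hbound

theorem integral_sphereProb_exp_mul_inner (ξ η : V) :
    ∫ v : sphere (0 : V) 1, Complex.exp (inner ℝ ξ v * Complex.I) * (inner ℝ η v : ℝ)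
        ∂sphereProb V =
      (besselPhi (finrank ℝ V + 2) ‖ξ‖ / finrank ℝ V * Complex.I) * (inner ℝ η ξ : ℝ) := by
  have hodd : ∫ v : sphere (0 : V) 1, inner ℝ η v * Real.cos (inner ℝ ξ v) ∂sphereProb V = 0 :=
    integral_sphereProb_eq_zero_of_odd (g := fun v => inner ℝ η v * Real.cos (inner ℝ ξ v))
      fun v => by simp
  have hsplit : ∀ v : V, Complex.exp (inner ℝ ξ v * Complex.I) * (inner ℝ η v : ℝ) =
      (inner ℝ η v * Real.cos (inner ℝ ξ v) : ℝ) +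
        (inner ℝ η v * Real.sin (inner ℝ ξ v) : ℝ) * Complex.I := fun v => by
    rw [Complex.exp_mul_I]
    push_cast
    ring
  simp only [hsplit]
  rw [integral_add (integrable_of_compactSpace _ (by fun_prop))
    (integrable_of_compactSpace _ (by fun_prop)), integral_mul_const, integral_complex_ofReal,
    integral_complex_ofReal, hodd, integral_sphereProb_inner_mul_sin, real_inner_comm]
  push_cast
  ring

theorem integral_sphereProb_exp_smul {E : Type*} [NormedAddCommGroup E] [NormedSpace ℂ E]
    [CompleteSpace E] (ξ : V) (L : V →L[ℝ] E) :
    ∫ v : sphere (0 : V) 1, Complex.exp (inner ℝ ξ v * Complex.I) • L v ∂sphereProb V =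
      (besselPhi (finrank ℝ V + 2) ‖ξ‖ / finrank ℝ V * Complex.I) • L ξ := by
  let b := stdOrthonormalBasis ℝ V
  have hL : ∀ (c : ℂ) (v : V), c • L v = ∑ i, (c * (inner ℝ (b i) v : ℝ)) • L (b i) := fun c v => by
    conv_lhs => rw [← b.sum_repr' v, map_sum, Finset.smul_sum]
    simp only [map_smul, ← Complex.coe_smul, smul_smul]
  rw [integral_congr_ae (.of_forall fun v : sphere (0 : V) 1 => hL _ v),
    integral_finsetSum _ fun i _ => integrable_of_compactSpace _ (by fun_prop), hL]
  simp only [integral_smul_const, integral_sphereProb_exp_mul_inner]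

end SphereIntegrals

section Algebra

theorem sum_smul_mul_sum_smul_add {ι R A : Type*} [CommSemiring R] [Semiring A] [Algebra R A]
    (s : Finset ι) (v w : ι → R) (a b : ι → A) :
    (∑ i ∈ s, v i • a i) * (∑ j ∈ s, w j • b j) + (∑ j ∈ s, w j • b j) * (∑ i ∈ s, v i • a i) =
      ∑ i ∈ s, ∑ j ∈ s, (v i * w j) • (a i * b j + b j * a i) := by
  simp only [Finset.sum_mul_sum, smul_mul_smul_comm, smul_add, Finset.sum_add_distrib]
  rw [Finset.sum_comm (f := fun j i => (w j * v i) • (b j * a i))]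
  simp only [mul_comm (w _)]

theorem smul_sub_star_mul_self {R A : Type*} [CommRing R] [Ring A] [Algebra R A] [StarRing A]
    {a : A} (ha : a * a = 0) (c : R) :
    (c • (a - star a)) * (c • (a - star a)) = (-(c * c)) • (a * star a + star a * a) := by
  have hstar : star a * star a = 0 := by rw [← star_mul, ha, star_zero]
  rw [smul_mul_smul_comm, sub_mul, mul_sub, mul_sub, ha, hstar, neg_smul, ← smul_neg]
  congr 1
  abel

theorem cfc_eq_algebraMap_of_even {A : Type*} [Ring A] [StarRing A] [TopologicalSpace A]
    [Algebra ℝ A] [ContinuousFunctionalCalculus ℝ A IsSelfAdjoint] {a : A} (ha : IsSelfAdjoint a)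
    {r : ℝ} (har : a * a = algebraMap ℝ A (r ^ 2)) {g : ℝ → ℝ} (hg : Function.Even g) :
    cfc g a = algebraMap ℝ A (g r) := by
  nontriviality A
  rw [← cfc_const (g r) a ha]
  refine cfc_congr fun x hx => ?_
  have hx2 : x ^ 2 ∈ spectrum ℝ (algebraMap ℝ A (r ^ 2)) := by
    rw [← har, ← sq]
    exact spectrum.pow_mem_pow a 2 hx
  rw [spectrum.scalar_eq, Set.mem_singleton_iff] at hx2
  rcases sq_eq_sq_iff_eq_or_eq_neg.1 hx2 with rfl | rfl
  · rfl
  · exact hg r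

end Algebra

section ExteriorAlgebra

variable {q : ℕ}

/-- The sign `(-1)^{#{j ∈ I : j < i}}` of the permutation that sorts `i` into `I`. -/
noncomputable def wedgeSign (I : Finset (Fin q)) (i : Fin q) : ℂ :=
  (-1 : ℂ) ^ (I.filter (· < i)).card

theorem wedgeSign_mul_self (I : Finset (Fin q)) (i : Fin q) :
    wedgeSign I i * wedgeSign I i = 1 := by
  rw [wedgeSign, ← mul_pow, neg_one_mul, neg_neg, one_pow]

theorem conj_wedgeSign (I : Finset (Fin q)) (i : Fin q) :
    (starRingEnd ℂ) (wedgeSign I i) = wedgeSign I i := by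
  simp [wedgeSign]

theorem wedgeSign_insert {I : Finset (Fin q)} {i : Fin q} (hi : i ∉ I) (j : Fin q) :
    wedgeSign (insert i I) j = if i < j then -wedgeSign I j else wedgeSign I j := by
  rw [wedgeSign, wedgeSign, Finset.filter_insert]
  split_ifs
  · rw [Finset.card_insert_of_notMem (by simp [hi]), pow_succ, mul_neg_one]
  · rfl

theorem wedgeSign_erase {I : Finset (Fin q)} {i : Fin q} (hi : i ∈ I) (j : Fin q) :
    wedgeSign (I.erase i) j = if i < j then -wedgeSign I j else wedgeSign I j := by
  have h := wedgeSign_insert (Finset.notMem_erase i I) j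
  rw [Finset.insert_erase hi] at h
  split_ifs at h ⊢
  · rw [h, neg_neg]
  · exact h.symm

theorem wedge_apply (i : Fin q) (ω : FormFiber q) (I : Finset (Fin q)) :
    wedge i ω I = if i ∈ I then wedgeSign I i * ω (I.erase i) else 0 :=
  rfl

theorem contract_apply (i : Fin q) (ω : FormFiber q) (I : Finset (Fin q)) :
    contract i ω I = if i ∈ I then 0 else wedgeSign I i * ω (insert i I) := by
  have h : contract i ω I = inner ℂ (wedge i (EuclideanSpace.single I (1 : ℂ))) ω := by
    rw [← ContinuousLinearMap.adjoint_inner_right, ← contract, EuclideanSpace.inner_single_left,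
      map_one, one_mul]
  rw [h, PiLp.inner_apply]
  simp only [wedge_apply]
  split_ifs with hi
  · refine Finset.sum_eq_zero fun J _ => ?_
    have : J.erase i ≠ I := fun h => Finset.notMem_erase i J (h ▸ hi)
    simp [this]
  · rw [Finset.sum_eq_single (insert i I)]
    · simp [hi, wedgeSign_insert hi, conj_wedgeSign, mul_comm]
    · intro J _ hJ
      by_cases hiJ : i ∈ J
      · have : J.erase i ≠ I := fun h => hJ (by rw [← h, Finset.insert_erase hiJ])
        simp [this]
      · simp [hiJ]
    · simp

theorem wedge_mul_wedge_of_lt {i j : Fin q} (hij : i < j) :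
    wedge i * wedge j = -(wedge j * wedge i) := by
  ext ω I
  simp only [mul_apply_eq_comp, _root_.neg_apply, PiLp.neg_apply, wedge_apply, Finset.mem_erase]
  by_cases hi : i ∈ I
  · by_cases hj : j ∈ I
    · simp [hi, hj, hij.ne, hij.ne', wedgeSign_erase, hij, hij.not_gt,
        Finset.erase_right_comm (a := i) (b := j), mul_left_comm]
    · simp [hj]
  · simp [hi]

theorem wedge_mul_wedge_add (i j : Fin q) : wedge i * wedge j + wedge j * wedge i = 0 := by
  rcases lt_trichotomy i j with h | rfl | h
  · rw [wedge_mul_wedge_of_lt h, neg_add_cancel]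
  · ext ω I
    simp [wedge_apply]
  · rw [wedge_mul_wedge_of_lt h, add_neg_cancel]

theorem wedge_mul_contract_add (i j : Fin q) :
    wedge i * contract j + contract j * wedge i = if i = j then 1 else 0 := by
  ext ω I
  simp only [_root_.add_apply, mul_apply_eq_comp, PiLp.add_apply, wedge_apply, contract_apply,
    Finset.mem_erase, Finset.mem_insert]
  rcases eq_or_ne i j with rfl | hij
  · by_cases hi : i ∈ I
    · simp [hi, wedgeSign_erase, ← mul_assoc, wedgeSign_mul_self]
    · simp [hi, wedgeSign_insert, ← mul_assoc, wedgeSign_mul_self]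
  · by_cases hi : i ∈ I
    · by_cases hj : j ∈ I
      · simp [hj, hij, hij.symm]
      · rcases hij.lt_or_gt with h | h <;>
          simp [hi, hj, hij, hij.symm, wedgeSign_erase, wedgeSign_insert, h, h.not_gt,
            Finset.erase_insert_of_ne hij.symm, mul_left_comm]
    · by_cases hj : j ∈ I <;> simp [hi, hj, hij]

/-- Exterior multiplication by the covector `v♭ = ∑ᵢ vᵢ dx_i`, as a linear function of `v`. -/
noncomputable def wedgeVec : Space q →L[ℝ] FormFiber q →L[ℂ] FormFiber q :=
  ∑ i, (EuclideanSpace.proj i : Space q →L[ℝ] ℝ).smulRight (wedge i)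

theorem wedgeVec_eq_sum (v : Space q) : wedgeVec v = ∑ i, v i • wedge i := by
  simp [wedgeVec]

theorem star_wedgeVec (v : Space q) : star (wedgeVec v) = ∑ i, v i • contract i := by
  refine ((congrArg star (wedgeVec_eq_sum v)).trans (star_sum _ _)).trans ?_
  refine Finset.sum_congr rfl fun i _ => (star_smul (v i : ℂ) (wedge i)).trans ?_
  exact congrArg (· • contract i) (Complex.conj_ofReal (v i))

theorem wedgeVec_mul_self (v : Space q) : wedgeVec v * wedgeVec v = 0 := by
  have h : wedgeVec v * wedgeVec v + wedgeVec v * wedgeVec v = 0 := by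
    rw [wedgeVec_eq_sum]
    refine (sum_smul_mul_sum_smul_add _ v v wedge wedge).trans ?_
    refine Finset.sum_eq_zero fun i _ => Finset.sum_eq_zero fun j _ => ?_
    rw [wedge_mul_wedge_add, smul_zero]
  ext ω I
  exact self_eq_neg.1 (eq_neg_of_add_eq_zero_left (congrArg (fun T => T ω I) h))

theorem wedgeVec_mul_star_add (v w : Space q) :
    wedgeVec v * star (wedgeVec w) + star (wedgeVec w) * wedgeVec v =
      algebraMap ℝ _ (inner ℝ v w) := by
  rw [star_wedgeVec, wedgeVec_eq_sum]
  refine (sum_smul_mul_sum_smul_add _ v w wedge contract).trans ?_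
  simp only [wedge_mul_contract_add, smul_ite, smul_zero, Finset.sum_ite_eq, Finset.mem_univ,
    if_true]
  rw [← Finset.sum_smul, Algebra.algebraMap_eq_smul_one, PiLp.inner_apply]
  simp [mul_comm]

end ExteriorAlgebra

section DiracSymbol

variable {q : ℕ} (ξ : Space q)

theorem diracSymbol_eq_wedgeVec :
    diracSymbol ξ = (2 * π * Complex.I) • (wedgeVec ξ - star (wedgeVec ξ)) := by
  ext1 ω
  rw [star_wedgeVec, wedgeVec_eq_sum, diracSymbol]
  simp only [_root_.smul_apply, _root_.sub_apply, _root_.sum_apply, ← Finset.sum_sub_distrib,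
    Finset.smul_sum, ← smul_sub, ← Complex.coe_smul, smul_smul]

theorem diracSymbol_mul_self :
    diracSymbol ξ * diracSymbol ξ = algebraMap ℝ _ ((2 * π * ‖ξ‖) ^ 2) := by
  have hI : -((2 * π * Complex.I) * (2 * π * Complex.I)) = (((2 * π) ^ 2 : ℝ) : ℂ) := by
    push_cast
    linear_combination -(2 * (π : ℂ)) ^ 2 * Complex.I_sq
  rw [diracSymbol_eq_wedgeVec]
  refine (smul_sub_star_mul_self (wedgeVec_mul_self ξ) _).trans ?_
  rw [wedgeVec_mul_star_add, real_inner_self_eq_norm_sq, hI]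
  ext1 ω
  simp only [_root_.smul_apply, ContinuousLinearMap.algebraMap_apply, Complex.coe_smul, smul_smul,
    mul_pow]

theorem cfc_diracSymbol_of_even {g : ℝ → ℝ} (hg : Function.Even g) :
    cfc g (diracSymbol ξ) = algebraMap ℝ _ (g (2 * π * ‖ξ‖)) :=
  cfc_eq_algebraMap_of_even (isSelfAdjoint_diracSymbol ξ) (diracSymbol_mul_self ξ) hg

end DiracSymbol

section FourierMultiplier

variable {V F : Type*} [NormedAddCommGroup V] [InnerProductSpace ℝ V] [FiniteDimensional ℝ V]
  [MeasurableSpace V] [BorelSpace V] [NormedAddCommGroup F] [InnerProductSpace ℂ F]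

theorem eq_of_forall_toLp {G : Type*} [NormedAddCommGroup G] [NormedSpace ℂ G]
    {T T' : Lp F 2 (volume : Measure V) →L[ℂ] G}
    (h : ∀ ω : 𝓢(V, F), T (ω.toLp 2) = T' (ω.toLp 2)) : T = T' :=
  DFunLike.coe_injective ((SchwartzMap.denseRange_toLpCLM (p := 2) ENNReal.ofNat_ne_top).equalizer
    T.continuous T'.continuous (funext h))

theorem inner_eq_integral_of_ae_eq {α : Type*} [MeasurableSpace α] {μ : Measure α}
    {f g : Lp F 2 μ} {f' g' : α → F} (hf : f =ᵐ[μ] f') (hg : g =ᵐ[μ] g') :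
    inner ℂ f g = ∫ x, inner ℂ (f' x) (g' x) ∂μ := by
  rw [L2.inner_def]
  refine integral_congr_ae ?_
  filter_upwards [hf, hg] with x hfx hgx
  rw [hfx, hgx]

theorem fourier_compSubConstCLM (a : V) (ω : 𝓢(V, F)) (ξ : V) :
    𝓕 (compSubConstCLM ℂ (-a) ω) ξ =
      Complex.exp (inner ℝ ((2 * π) • ξ) a * Complex.I) • 𝓕 ω ξ := by
  have h := congrFun (VectorFourier.fourierIntegral_comp_add_right Real.fourierChar
    (volume : Measure V) (innerₗ V) ω a) ξ
  rw [Circle.smul_def, Real.fourierChar_apply, innerₗ_apply_apply, real_inner_comm,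
    ← real_inner_smul_left] at h
  have hcomp : (compSubConstCLM ℂ (-a) ω : V → F) = ω ∘ fun x => x + a := by
    ext x
    simp
  rw [SchwartzMap.fourier_coe, hcomp]
  exact h

variable [CompleteSpace F]

theorem fourier_postcompCLM {G : Type*} [NormedAddCommGroup G] [NormedSpace ℂ G]
    [CompleteSpace G] (L : F →L[ℂ] G) (ω : 𝓢(V, F)) :
    𝓕 (postcompCLM L ω) = postcompCLM L (𝓕 ω) := by
  ext1 ξ
  rw [postcompCLM_apply, SchwartzMap.fourier_coe, SchwartzMap.fourier_coe, Real.fourier_eq,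
    Real.fourier_eq, ← L.integral_comp_comm]
  · simp only [Circle.smul_def, map_smul, postcompCLM_apply]
  · rw [Real.fourierIntegral_convergent_iff]
    exact ω.integrable

theorem integral_inner_fourier_exp_smul (v : V) (A : F →L[ℂ] F) (ψ ω : 𝓢(V, F)) :
    ∫ ξ, inner ℂ (𝓕 ψ ξ) (Complex.exp (inner ℝ ((2 * π) • ξ) v * Complex.I) • A (𝓕 ω ξ)) =
      ∫ x, inner ℂ (ψ x) (A (ω (x + v))) := by
  have h := integral_inner_fourier_fourier ψ (postcompCLM A (compSubConstCLM ℂ (-v) ω))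
  simpa only [fourier_postcompCLM, postcompCLM_apply, fourier_compSubConstCLM,
    compSubConstCLM_apply, sub_neg_eq_add, map_smul] using h

/-- The bounded operator `B` acts as multiplication by `M` in the frequency domain. -/
def IsFourierMultiplier (M : V → F →L[ℂ] F)
    (B : Lp F 2 (volume : Measure V) →L[ℂ] Lp F 2 (volume : Measure V)) : Prop :=
  ∀ f, ∀ᵐ ξ, (𝓕 (B f) : Lp F 2 (volume : Measure V)) ξ =
    M ξ ((𝓕 f : Lp F 2 (volume : Measure V)) ξ)

variable {M : V → F →L[ℂ] F}

theorem exists_isFourierMultiplier (hM : MemLp M ⊤ volume) :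
    ∃ B, IsFourierMultiplier M B := by
  let U := (Lp.fourierTransformₗᵢ V F).toContinuousLinearEquiv
  let mulM := (ContinuousLinearMap.id ℂ (F →L[ℂ] F)).holderL volume ⊤ 2 2 hM.toLp
  refine ⟨U.symm.toContinuousLinearMap ∘L mulM ∘L U.toContinuousLinearMap, fun f => ?_⟩
  have hU : 𝓕 ((U.symm.toContinuousLinearMap ∘L mulM ∘L U.toContinuousLinearMap) f) =
      mulM (𝓕 f) :=
    U.apply_symm_apply (mulM (𝓕 f))
  rw [hU]
  filter_upwards [hM.coeFn_toLp, ContinuousLinearMap.coeFn_holder (r := 2)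
    (ContinuousLinearMap.id ℂ (F →L[ℂ] F)) hM.toLp (𝓕 f)] with ξ hMξ hmul
  rw [← hMξ]
  exact hmul

namespace IsFourierMultiplier

variable {B B' : Lp F 2 (volume : Measure V) →L[ℂ] Lp F 2 (volume : Measure V)}

theorem eq (h : IsFourierMultiplier M B) (h' : IsFourierMultiplier M B') : B = B' := by
  ext1 f
  apply (Lp.fourierTransformₗᵢ V F).injective
  ext1
  filter_upwards [h f, h' f] with ξ hξ hξ'
  exact hξ.trans hξ'.symm

theorem fourier_toLp (h : IsFourierMultiplier M B) (ω : 𝓢(V, F)) :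
    (𝓕 (B (ω.toLp 2)) : Lp F 2 (volume : Measure V)) =ᵐ[volume] fun ξ => M ξ (𝓕 ω ξ) := by
  filter_upwards [h (ω.toLp 2), (𝓕 ω).coeFn_toLp 2 volume] with ξ hξ hω
  rw [hξ, SchwartzMap.toLp_fourier_eq, hω]

theorem inner_toLp (h : IsFourierMultiplier M B) (ψ ω : 𝓢(V, F)) :
    inner ℂ (ψ.toLp 2) (B (ω.toLp 2)) = ∫ ξ, inner ℂ (𝓕 ψ ξ) (M ξ (𝓕 ω ξ)) := by
  rw [← Lp.inner_fourier_eq, SchwartzMap.toLp_fourier_eq]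
  exact inner_eq_integral_of_ae_eq ((𝓕 ψ).coeFn_toLp 2 volume) (h.fourier_toLp ω)

end IsFourierMultiplier

end FourierMultiplier

section TranslationAverage

variable {V F Y : Type*} [NormedAddCommGroup V] [TopologicalSpace Y] [CompactSpace Y]

theorem hasCompactSupport_comp_add [Zero F] {a : Y → V} {f : V → F} (ha : Continuous a)
    (hf : HasCompactSupport f) : HasCompactSupport fun z : V × Y => f (z.1 + a z.2) := by
  let shear : V × Y ≃ₜ V × Y :=
    { toFun := fun z => (z.1 + a z.2, z.2)
      invFun := fun z => (z.1 - a z.2, z.2)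
      left_inv := fun z => by simp
      right_inv := fun z => by simp }
  have hfst : HasCompactSupport fun z : V × Y => f z.1 :=
    HasCompactSupport.intro' (hf.isCompact.prod isCompact_univ)
      ((isClosed_tsupport f).prod isClosed_univ)
      fun z hz => image_eq_zero_of_notMem_tsupport fun h => hz ⟨h, Set.mem_univ _⟩
  exact hfst.comp_homeomorph shear

variable [MeasurableSpace Y] [NormedAddCommGroup F] [InnerProductSpace ℂ F]

/-- The operator taking `f` to the superposition `∫ L y (f (· + a y)) dμ(y)` of translates of `f`,
weighted by the operators `L y`. -/
noncomputable def translationAverage (μ : Measure Y) (a : Y → V) (L : Y → F →L[ℂ] F) (f : V → F)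
    (x : V) : F :=
  ∫ y, L y (f (x + a y)) ∂μ

variable {μ : Measure Y} {a : Y → V} {L : Y → F →L[ℂ] F} {f ψ : V → F}

theorem hasCompactSupport_translationAverage (ha : Continuous a) (hf : HasCompactSupport f) :
    HasCompactSupport (translationAverage μ a L f) := by
  refine HasCompactSupport.intro
    ((hasCompactSupport_comp_add ha hf).isCompact.image continuous_fst) fun x hx => ?_
  have hzero : ∀ y, f (x + a y) = 0 := fun y => by
    contrapose! hx
    exact ⟨(x, y), subset_tsupport _ hx, rfl⟩
  simp only [translationAverage, hzero, map_zero, integral_zero]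

variable [OpensMeasurableSpace Y] [IsFiniteMeasure μ]

theorem continuous_translationAverage [SecondCountableTopology Y] [LocallyCompactSpace V]
    (ha : Continuous a) (hL : Continuous L) (hf : Continuous f) :
    Continuous (translationAverage μ a L f) :=
  continuous_integral_of_compactSpace μ (f := fun x y => L y (f (x + a y))) (by fun_prop)

theorem inner_translationAverage [CompleteSpace F] (ha : Continuous a) (hL : Continuous L)
    (hf : Continuous f) (c : F) (x : V) :
    inner ℂ c (translationAverage μ a L f x) = ∫ y, inner ℂ c (L y (f (x + a y))) ∂μ :=
  (integral_inner (integrable_of_compactSpace μ (by fun_prop)) c).symm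

variable [InnerProductSpace ℝ V]

/-- The Fourier multiplier of `translationAverage μ a L`: the inverse Fourier transform of the image
of `μ` under `a`, weighted by `L`. -/
noncomputable def translationSymbol (μ : Measure Y) (a : Y → V) (L : Y → F →L[ℂ] F) (ξ : V) :
    F →L[ℂ] F :=
  ∫ y, Complex.exp (inner ℝ ((2 * π) • ξ) (a y) * Complex.I) • L y ∂μ

theorem inner_translationSymbol [CompleteSpace F] (ha : Continuous a) (hL : Continuous L)
    (ξ : V) (c e : F) :
    inner ℂ c (translationSymbol μ a L ξ e) =
      ∫ y, inner ℂ c (Complex.exp (inner ℝ ((2 * π) • ξ) (a y) * Complex.I) • L y e) ∂μ := by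
  rw [translationSymbol, ContinuousLinearMap.integral_apply, ← integral_inner]
  · rfl
  · exact integrable_of_compactSpace μ (by fun_prop)
  · exact integrable_of_compactSpace μ (by fun_prop)

variable [FiniteDimensional ℝ V] [MeasurableSpace V] [BorelSpace V]

theorem memLp_top_translationSymbol [SecondCountableTopology Y] (ha : Continuous a)
    (hL : Continuous L) : MemLp (translationSymbol μ a L) ⊤ volume := by
  have hcont : Continuous (translationSymbol μ a L) :=
    continuous_integral_of_compactSpace μ
      (f := fun ξ y => Complex.exp (inner ℝ ((2 * π) • ξ) (a y) * Complex.I) • L y) (by fun_prop)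
  refine memLp_top_of_bound hcont.aestronglyMeasurable (∫ y, ‖L y‖ ∂μ) (.of_forall fun ξ => ?_)
  refine (norm_integral_le_integral_norm _).trans_eq ?_
  simp only [norm_smul, Complex.norm_exp_ofReal_mul_I, one_mul]

theorem integrable_inner_exp_smul (ha : Continuous a) (hL : Continuous L) (ψ ω : 𝓢(V, F)) :
    Integrable (Function.uncurry fun (ξ : V) (y : Y) =>
      inner ℂ (ψ ξ) (Complex.exp (inner ℝ ((2 * π) • ξ) (a y) * Complex.I) • L y (ω ξ)))
      (volume.prod μ) := by
  have hprod : Integrable (fun ξ => ‖ψ ξ‖ * ‖ω ξ‖) volume :=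
    (ψ.memLp 2).norm.integrable_mul (ω.memLp 2).norm
  refine (hprod.mul_prod (integrable_of_compactSpace μ hL).norm).mono'
    (Continuous.aestronglyMeasurable (by fun_prop)) (.of_forall fun z => ?_)
  refine (norm_inner_le_norm _ _).trans ?_
  rw [norm_smul, Complex.norm_exp_ofReal_mul_I, one_mul, mul_assoc, mul_comm ‖ω z.1‖]
  exact mul_le_mul_of_nonneg_left ((L z.2).le_opNorm _) (norm_nonneg _)

variable [CompleteSpace F]

theorem integral_inner_translationAverage (ha : Continuous a) (hL : Continuous L)
    (hψ : Continuous ψ) (hψs : HasCompactSupport ψ) (hf : Continuous f) :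
    ∫ x, inner ℂ (ψ x) (translationAverage μ a L f x) =
      ∫ y, ∫ x, inner ℂ (ψ x) (L y (f (x + a y))) ∂volume ∂μ := by
  simp only [inner_translationAverage ha hL hf]
  refine integral_integral_swap_of_hasCompactSupport (by fun_prop) ?_
  refine (hasCompactSupport_comp_add (a := fun _ : Y => (0 : V)) continuous_const hψs).mono
    fun z hz hψz => hz ?_
  simp only [add_zero] at hψz
  simp only [Function.uncurry, hψz, inner_zero_left]

theorem integral_inner_translationAverage_adjoint (ha : Continuous a) (hL : Continuous L)
    (hψ : Continuous ψ) (hψs : HasCompactSupport ψ) (hf : Continuous f) :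
    ∫ x, inner ℂ (translationAverage μ (-a) (fun y => (L y).adjoint) ψ x) (f x) =
      ∫ x, inner ℂ (ψ x) (translationAverage μ a L f x) := by
  have hL' : Continuous fun y => (L y).adjoint := ContinuousLinearMap.adjoint.continuous.comp hL
  have hpt : ∀ x, inner ℂ (translationAverage μ (-a) (fun y => (L y).adjoint) ψ x) (f x) =
      ∫ y, inner ℂ (ψ (x + -a y)) (L y (f x)) ∂μ := fun x => by
    rw [← inner_conj_symm, inner_translationAverage ha.neg hL' hψ, ← integral_conj]
    simp only [inner_conj_symm, ContinuousLinearMap.adjoint_inner_left, Pi.neg_apply]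
  simp only [hpt]
  rw [integral_inner_translationAverage ha hL hψ hψs hf,
    integral_integral_swap_of_hasCompactSupport (by fun_prop)]
  · congr 1 with y
    rw [← integral_add_right_eq_self _ (a y)]
    simp only [add_neg_cancel_right]
  · refine (hasCompactSupport_comp_add ha.neg hψs).mono fun z hz hψz => hz ?_
    simp only [Pi.neg_apply] at hψz
    simp only [Function.uncurry, hψz, inner_zero_left]

namespace IsFourierMultiplier

variable {B : Lp F 2 (volume : Measure V) →L[ℂ] Lp F 2 (volume : Measure V)}

theorem inner_toLp_translationSymbol (h : IsFourierMultiplier (translationSymbol μ a L) B)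
    (ha : Continuous a) (hL : Continuous L) (ψ ω : 𝓢(V, F)) (hψ : HasCompactSupport ψ) :
    inner ℂ (ψ.toLp 2) (B (ω.toLp 2)) = ∫ x, inner ℂ (ψ x) (translationAverage μ a L ω x) := by
  rw [h.inner_toLp, integral_inner_translationAverage ha hL ψ.continuous hψ ω.continuous]
  simp only [inner_translationSymbol ha hL]
  rw [integral_integral_swap (integrable_inner_exp_smul ha hL (𝓕 ψ) (𝓕 ω))]
  simp only [integral_inner_fourier_exp_smul]

theorem adjoint_toLp_translationSymbol [SecondCountableTopology Y]
    (h : IsFourierMultiplier (translationSymbol μ a L) B) (ha : Continuous a) (hL : Continuous L)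
    (ψ : 𝓢(V, F)) (hψ : HasCompactSupport ψ) :
    B.adjoint (ψ.toLp 2) =ᵐ[volume] translationAverage μ (-a) (fun y => (L y).adjoint) ψ := by
  have hL' : Continuous fun y => (L y).adjoint := ContinuousLinearMap.adjoint.continuous.comp hL
  have hmem : MemLp (translationAverage μ (-a) (fun y => (L y).adjoint) ψ) 2 volume :=
    (continuous_translationAverage ha.neg hL' ψ.continuous).memLp_of_hasCompactSupport
      (hasCompactSupport_translationAverage ha.neg hψ)
  suffices heq : B.adjoint (ψ.toLp 2) = hmem.toLp by
    rw [heq]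
    exact hmem.coeFn_toLp
  have hinner : innerSL ℂ (B.adjoint (ψ.toLp 2)) = innerSL ℂ hmem.toLp :=
    eq_of_forall_toLp fun ω => by
      rw [innerSL_apply_apply, innerSL_apply_apply, ContinuousLinearMap.adjoint_inner_left,
        h.inner_toLp_translationSymbol ha hL ψ ω hψ,
        inner_eq_integral_of_ae_eq hmem.coeFn_toLp (ω.coeFn_toLp 2 volume),
        integral_inner_translationAverage_adjoint ha hL ψ.continuous hψ ω.continuous]
  exact ext_inner_right ℂ fun g => DFunLike.congr_fun hinner g

end IsFourierMultiplier

end TranslationAverage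

section DeformedExtD

variable {q : ℕ} {t : ℝ}

theorem fourier_extD (ω : 𝓢(Space q, FormFiber q)) (ξ : Space q) :
    𝓕 (extD ω) ξ = (2 * π * Complex.I) • wedgeVec ξ (𝓕 ω ξ) := by
  have hderiv : ∀ i : Fin q,
      𝓕 (∂_{stdVec i} ω) ξ = (2 * π * Complex.I) • (ξ i : ℂ) • 𝓕 ω ξ := fun i => by
    have htemp : (inner ℝ · (stdVec i) : Space q → ℝ).HasTemperateGrowth :=
      ((innerSL ℝ).flip (stdVec i)).hasTemperateGrowth
    have hcoord : inner ℝ ξ (stdVec i) = ξ i := by simp [EuclideanSpace.inner_single_right]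
    rw [fourier_lineDerivOp_eq, _root_.smul_apply, smulLeftCLM_apply_apply htemp, hcoord,
      Complex.coe_smul]
  simp only [extD, FourierTransform.fourier_sum, fourier_postcompCLM, _root_.sum_apply,
    postcompCLM_apply, hderiv, map_smul, wedgeVec_eq_sum, Finset.smul_sum, _root_.smul_apply,
    ← Complex.coe_smul]

theorem exists_isFunctionOfDirac {g : ℝ → ℝ} {C : ℝ} (hg : Continuous g)
    (heven : Function.Even g) (hC : ∀ r, |g r| ≤ C) :
    ∃ Φ : FormL2 q →L[ℂ] FormL2 q, IsFunctionOfDirac g Φ := by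
  have hcont : Continuous fun ξ : Space q =>
      algebraMap ℝ (FormFiber q →L[ℂ] FormFiber q) (g (2 * π * ‖ξ‖)) :=
    (algebraMapCLM ℝ (FormFiber q →L[ℂ] FormFiber q)).continuous.comp (by fun_prop)
  have hmem : MemLp (fun ξ : Space q => cfc g (diracSymbol ξ)) ⊤ volume := by
    simp only [cfc_diracSymbol_of_even _ heven]
    refine memLp_top_of_bound hcont.aestronglyMeasurable C (.of_forall fun ξ => ?_)
    rw [norm_algebraMap']
    exact hC _
  exact exists_isFourierMultiplier hmem

/-- The symbol of the deformed exterior derivative `t φ_{q+2}(tD) d`: since `D²` has symbol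
`(2π|ξ|)²` and `φ_{q+2}` is even, it is `t φ_{q+2}(2πt|ξ|)` times the symbol `2πi ξ♭ ∧ ·` of `d`. -/
noncomputable def deformedSymbol (t : ℝ) (ξ : Space q) : FormFiber q →L[ℂ] FormFiber q :=
  (t * besselPhi (q + 2) (t * (2 * π * ‖ξ‖)) * (2 * π * Complex.I)) • wedgeVec ξ

theorem IsFourierMultiplier.isDeformedExtD {T : FormL2 q →L[ℂ] FormL2 q}
    (hT : IsFourierMultiplier (deformedSymbol t) T) : IsDeformedExtD t T := by
  have heven : Function.Even fun r => besselPhi (q + 2) (t * r) := fun r => by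
    simp only [mul_neg, even_besselPhi (q + 2) (t * r)]
  have hq : 1 ≤ q + 2 := Nat.le_add_left 1 (q + 1)
  have hcont : Continuous fun r => besselPhi (q + 2) (t * r) :=
    (continuous_besselPhi hq).comp (continuous_const_mul t)
  obtain ⟨Φ, hΦ⟩ := exists_isFunctionOfDirac (q := q) hcont heven
    fun r => abs_besselPhi_le_one hq (t * r)
  refine ⟨Φ, hΦ, fun ω => (Lp.fourierTransformₗᵢ (Space q) (FormFiber q)).injective ?_⟩
  rw [map_smul]
  ext1
  have hΦω := IsFourierMultiplier.fourier_toLp hΦ (extD ω)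
  filter_upwards [hT.fourier_toLp ω, hΦω, Lp.coeFn_smul (t : ℂ) (𝓕 (Φ ((extD ω).toLp 2)))]
    with ξ hTξ hΦξ hsmul
  refine hTξ.trans (Eq.trans ?_ hsmul.symm)
  rw [Pi.smul_apply, hΦξ, cfc_diracSymbol_of_even ξ heven, fourier_extD, deformedSymbol,
    ContinuousLinearMap.algebraMap_apply, ← Complex.coe_smul, _root_.smul_apply, smul_smul,
    smul_smul]

theorem IsDeformedExtD.unique {T T' : FormL2 q →L[ℂ] FormL2 q} (h : IsDeformedExtD t T)
    (h' : IsDeformedExtD t T') : T = T' := by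
  obtain ⟨Φ, hΦ, hT⟩ := h
  obtain ⟨Φ', hΦ', hT'⟩ := h'
  obtain rfl : Φ = Φ' := IsFourierMultiplier.eq hΦ hΦ'
  exact eq_of_forall_toLp fun ω => (hT ω).trans (hT' ω).symm

/-- The operator `q ν♭ ∧ ·`, where `ν` is the outward unit normal at a point of the unit sphere. -/
noncomputable def normalWedge (v : Metric.sphere (0 : Space q) 1) : FormFiber q →L[ℂ] FormFiber q :=
  (q : ℂ) • wedgeVec (v : Space q)

theorem continuous_normalWedge : Continuous (normalWedge (q := q)) :=
  (wedgeVec.continuous.comp continuous_subtype_val).const_smul (q : ℂ)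

theorem translationSymbol_normalWedge [NeZero q] (t : ℝ) :
    translationSymbol (sphereProb (Space q)) (fun v => t • (v : Space q)) normalWedge =
      deformedSymbol t := by
  ext1 ξ
  have hq : (q : ℂ) ≠ 0 := Nat.cast_ne_zero.2 (NeZero.ne q)
  have hphi : besselPhi (q + 2) ‖t • (2 * π) • ξ‖ = besselPhi (q + 2) (t * (2 * π * ‖ξ‖)) := by
    rw [norm_smul, norm_smul, Real.norm_of_nonneg Real.two_pi_pos.le, Real.norm_eq_abs]
    rcases abs_choice t with ht | ht
    · rw [ht]
    · rw [ht, neg_mul, even_besselPhi]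
  calc
    _ = ∫ v : Metric.sphere (0 : Space q) 1, (q : ℂ) •
          Complex.exp (inner ℝ (t • (2 * π) • ξ) (v : Space q) * Complex.I) •
            wedgeVec (v : Space q) ∂sphereProb (Space q) := by
      simp only [translationSymbol, normalWedge, real_inner_smul_left, real_inner_smul_right,
        smul_comm (q : ℂ), mul_left_comm t]
    _ = (q : ℂ) • (besselPhi (q + 2) (t * (2 * π * ‖ξ‖)) / q * Complex.I) •
          wedgeVec (t • (2 * π) • ξ) := by
      rw [integral_smul, integral_sphereProb_exp_smul, finrank_euclideanSpace_fin, hphi]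
    _ = deformedSymbol t ξ := by
      rw [deformedSymbol]
      ext1 ω
      simp only [map_smul, _root_.smul_apply, ← Complex.coe_smul, smul_smul]
      congr 1
      field_simp
      push_cast
      ring

theorem memLp_top_deformedSymbol [NeZero q] (t : ℝ) :
    MemLp (deformedSymbol (q := q) t) ⊤ volume := by
  rw [← translationSymbol_normalWedge]
  exact memLp_top_translationSymbol (by fun_prop) continuous_normalWedge

end DeformedExtD

section AverageFlux

variable {n k : ℕ}

theorem wedgeVec_formCoords {q : ℕ} (ν : Space q) (α : Space q [⋀^Fin k]→L[ℝ] ℂ) :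
    wedgeVec ν (formCoords α) =
      formCoords (ContinuousAlternatingMap.alternatizeUncurryFin ((innerSL ℝ ν).smulRight α)) := by
  let f : Space q →L[ℝ] Space q [⋀^Fin k]→L[ℝ] ℂ := (innerSL ℝ ν).smulRight α
  have hderiv : fderiv ℝ (fun y => formCoords (f y)) 0 = formCoords.comp f :=
    (formCoords.comp f).fderiv
  have h := formCoords_extDeriv f 0 f.differentiableAt
  rw [extDeriv, f.fderiv, hderiv] at h
  rw [h, wedgeVec_eq_sum]
  simp [f, EuclideanSpace.inner_single_right]

theorem formCoords_eq_volForm {q : ℕ} (α : Space q [⋀^Fin q]→L[ℝ] ℂ) :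
    formCoords α = volForm (α stdVec) := by
  ext I
  rw [formCoords_apply, volForm]
  by_cases hI : I = Finset.univ
  · subst hI
    have hcard : (Finset.univ : Finset (Fin q)).card = q := Finset.card_fin q
    have hid : id = (Finset.univ : Finset (Fin q)).orderEmbOfFin hcard :=
      Finset.orderEmbOfFin_unique hcard (fun _ => Finset.mem_univ _) strictMono_id
    simp [← hid]
  · have hcard : I.card ≠ q := by
      rwa [← Finset.card_eq_iff_eq_univ, Fintype.card_fin] at hI
    simp [hI, hcard]

theorem wedgeVec_formCoords_eq_volForm (ν : Space (n + 1))
    (α : Space (n + 1) [⋀^Fin n]→L[ℝ] ℂ) :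
    wedgeVec ν (formCoords α) = volForm (fluxDensity ν α) := by
  rw [wedgeVec_formCoords, formCoords_eq_volForm, fluxDensity]

variable {t : ℝ} {f : Space (n + 1) → Space (n + 1) [⋀^Fin n]→L[ℝ] ℂ}

theorem averageFlux_eq_integral_sphereProb (ht : 0 < t) (hf : Continuous f) (p : Space (n + 1)) :
    averageFlux f t p = ∫ v : Metric.sphere (0 : Space (n + 1)) 1,
      fluxDensity (v : Space (n + 1)) (f (p + t • v)) ∂sphereProb (Space (n + 1)) := by
  have hdensity : ∀ (ν : Space (n + 1)) α,
      fluxDensity ν α = wedgeVec ν (formCoords α) Finset.univ := fun ν α => by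
    simp [wedgeVec_formCoords_eq_volForm, volForm]
  have hcont : Continuous fun x => fluxDensity (t⁻¹ • (x - p)) (f x) := by
    simp only [hdensity]
    fun_prop
  have hpush : Continuous fun v : Metric.sphere (0 : Space (n + 1)) 1 =>
      p + t • (v : Space (n + 1)) := by
    fun_prop
  have htn : (0 : ℝ) < t ^ n := by positivity
  rw [averageFlux, flux, waveFrontMeasure, integral_smul_measure,
    integral_map hpush.aemeasurable hcont.aestronglyMeasurable, measureReal_ennreal_smul_apply,
    map_measureReal_apply hpush.measurable MeasurableSet.univ, Set.preimage_univ, sphereProb,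
    integral_smul_measure, ENNReal.toReal_ofReal htn.le, ENNReal.toReal_inv, ← Measure.real]
  simp only [add_sub_cancel_left, smul_smul, inv_mul_cancel₀ ht.ne', one_smul, Complex.real_smul]
  push_cast
  rw [mul_inv, mul_comm ((t : ℂ) ^ n)⁻¹, mul_assoc, inv_mul_cancel_left₀]
  exact_mod_cast htn.ne'

theorem translationAverage_formCoords (ht : 0 < t) (hf : Continuous f) (p : Space (n + 1)) :
    translationAverage (sphereProb (Space (n + 1))) (fun v => t • (v : Space (n + 1))) normalWedge
      (fun x => formCoords (f x)) p = volForm (((n + 1 : ℕ) : ℂ) * averageFlux f t p) := by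
  have hvol : ∀ c : ℂ,
      volForm (q := n + 1) c = c • EuclideanSpace.single Finset.univ (1 : ℂ) := fun c => by
    ext I
    simp [volForm]
  rw [averageFlux_eq_integral_sphereProb ht hf, translationAverage]
  simp only [normalWedge, _root_.smul_apply, wedgeVec_formCoords_eq_volForm, hvol]
  rw [integral_smul, integral_smul_const, smul_smul]

end AverageFlux

section DistributionalImage

variable {q : ℕ} {T : FormL2 q →L[ℂ] FormL2 q}

theorem IsFourierMultiplier.isDistributionalImage {Y : Type*} [TopologicalSpace Y] [CompactSpace Y]
    [SecondCountableTopology Y] [MeasurableSpace Y] [OpensMeasurableSpace Y] {μ : Measure Y}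
    [IsFiniteMeasure μ] {a : Y → Space q} {L : Y → FormFiber q →L[ℂ] FormFiber q}
    {f : Space q → FormFiber q} (hT : IsFourierMultiplier (translationSymbol μ a L) T)
    (ha : Continuous a) (hL : Continuous L) (hf : Continuous f) :
    IsDistributionalImage T f (translationAverage μ a L f) := by
  intro ψ hψ
  set Aψ := translationAverage μ (-a) (fun y => (L y).adjoint) ψ
  have hL' : Continuous fun y => (L y).adjoint := ContinuousLinearMap.adjoint.continuous.comp hL
  have hcont : Continuous Aψ := continuous_translationAverage ha.neg hL' ψ.continuous
  have hsupp : HasCompactSupport Aψ := hasCompactSupport_translationAverage ha.neg hψ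
  have hae : (fun x => inner ℂ (T.adjoint (ψ.toLp 2) x) (f x)) =ᵐ[volume]
      fun x => inner ℂ (Aψ x) (f x) := by
    filter_upwards [hT.adjoint_toLp_translationSymbol ha hL ψ hψ] with x hx
    rw [hx]
  have hint : Integrable (fun x => inner ℂ (Aψ x) (f x)) volume :=
    (hcont.inner hf).integrable_of_hasCompactSupport <| hsupp.mono fun x hx hAψ => hx <| by
      simp only [hAψ, inner_zero_left]
  refine ⟨hint.congr hae.symm, (integral_congr_ae hae).trans ?_⟩
  exact integral_inner_translationAverage_adjoint ha hL ψ.continuous hψ hf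

theorem IsDistributionalImage.ae_eq {f u : Space q → FormFiber q}
    (h : IsDistributionalImage T f u) (hu : Continuous u) (hf : MemLp f 2 volume) :
    T hf.toLp =ᵐ[volume] u := by
  have hTf : LocallyIntegrable (T hf.toLp) volume :=
    (Lp.memLp (T hf.toLp)).locallyIntegrable one_le_two
  have hloc : LocallyIntegrable u volume := hu.locallyIntegrable
  refine ae_eq_of_integral_contDiff_smul_eq hTf hloc fun g hg hgs => ext_inner_left ℂ fun c => ?_
  have hψs : HasCompactSupport fun x => g x • c := hgs.smul_right
  let ψ : 𝓢(Space q, FormFiber q) := hψs.toSchwartzMap (hg.smul contDiff_const)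
  have hψ : ∀ x, ψ x = (g x : ℂ) • c := fun x => (Complex.coe_smul (g x) c).symm
  have htest : ∫ x, inner ℂ (ψ x) (T hf.toLp x) = ∫ x, inner ℂ (ψ x) (u x) := by
    rw [← (h ψ hψs).2, ← inner_eq_integral_of_ae_eq (ψ.coeFn_toLp 2 volume) (ae_eq_refl _),
      ← ContinuousLinearMap.adjoint_inner_left]
    exact inner_eq_integral_of_ae_eq (ae_eq_refl _) hf.coeFn_toLp
  rw [← integral_inner (hTf.integrable_smul_left_of_hasCompactSupport hg.continuous hgs),
    ← integral_inner (hloc.integrable_smul_left_of_hasCompactSupport hg.continuous hgs)]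
  simpa only [hψ, ← Complex.coe_smul, inner_smul_left, inner_smul_right, Complex.conj_ofReal]
    using htest

end DistributionalImage

theorem mainTheorem3 (n : ℕ) (t : ℝ) (ht : 0 < t) :
    ∃ T : FormL2 (n + 1) →L[ℂ] FormL2 (n + 1),
      IsDeformedExtD t T ∧ (∀ T', IsDeformedExtD t T' → T' = T) ∧
      ∀ f : Space (n + 1) → Space (n + 1) [⋀^Fin n]→L[ℝ] ℂ, Continuous f →
        ∃ u : Space (n + 1) → FormFiber (n + 1),
          Continuous u ∧
          (∀ p, u p = volForm (((n + 1 : ℕ) : ℂ) * averageFlux f t p)) ∧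
          IsDistributionalImage T (fun x => formCoords (f x)) u ∧
          ∀ hf : MemLp (fun x => formCoords (f x)) 2 (volume : Measure (Space (n + 1))),
            ∀ᵐ p, T hf.toLp p = u p := by
  obtain ⟨T, hT⟩ := exists_isFourierMultiplier (memLp_top_deformedSymbol (q := n + 1) t)
  refine ⟨T, hT.isDeformedExtD, fun T' h => h.unique hT.isDeformedExtD, fun f hf => ?_⟩
  rw [← translationSymbol_normalWedge] at hT
  have ha : Continuous fun v : Metric.sphere (0 : Space (n + 1)) 1 => t • (v : Space (n + 1)) := by
    fun_prop
  have hF : Continuous fun x => formCoords (f x) := by fun_prop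
  have hu := continuous_translationAverage (μ := sphereProb (Space (n + 1))) ha
    continuous_normalWedge hF
  have hdist := hT.isDistributionalImage ha continuous_normalWedge hF
  exact ⟨_, hu, translationAverage_formCoords ht hf, hdist, hdist.ae_eq hu⟩
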